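/- Let $k$ be a field of characteristic $0$, let $\mathfrak g$ be a Lie algebra over $k$ with bracket $[xy]$, and let $\{a_i\}_{i\in I}$ be a linear basis of $\mathfrak g$ indexed by a linearly ordered set $I$. **Conventions.** For $m,N\in\mathbb Z_{\ge0}^n$ write $m\prec N$ if $m_t<N_t$ for every $t$. An $n$-conformal algebra is a $k$-space $C$ with bilinear products $\langle m\rangle$, $m\in\mathbb Z_{\ge 0}^n$, and commuting linear maps $D_1,\dots,D_n$ such that: for all $a,b$ there is $N$ with $a\langle m\rangle b=0$ whenever $m\not\prec N$; $D_t(a\langle m\rangle b)=D_ta\langle m\rangle b+a\langle m\rangle D_tb$; and $D_ta\langle m\rangle b=-m_t\,a\langle m-e_t\rangle b$. It is associative if $(a\langle m\rangle b)\langle m'\rangle c=\sum_{s}(-1)^{s}\binom ms a\langle m-s\rangle(b\langle m'+s\rangle c)$, where $(-1)^s=(-1)^{s_1+\cdots+s_n}$, $\binom ms=\prod_t\binom{m_t}{s_t}$. Let $C(B,N,D_1,\dots,D_n)$ be the free associative $n$-conformal algebra generated by $B$ subject to $a\langle m\rangle b=0$ for $a,b\in B$, $m\not\prec N$ (with a fixed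 $N$). Put $D^i=D_1^{i_1}\cdots D_n^{i_n}$. A normal word is $[w]=b_1\langle m^{(1)}\rangle(b_2\langle m^{(2)}\rangle(\cdots(b_l\langle m^{(l)}\rangle D^{i}b_{l+1})\cdots))$ with $b_j\in B$, $m^{(j)}\prec N$, where $w=b_1\langle m^{(1)}\rangle\cdots b_l\langle m^{(l)}\rangle D^ib_{l+1}$ is the associative word; $|w|=l+1$; words are ordered lexicographically by $(|w|,b_1,m^{(1)},\dots,b_l,m^{(l)},b_{l+1},i)$, vectors also lexicographically. A word is $D$-free if $i=0$, and an element is $D$-free if it is a combination of $D$-free normal words. Every nonzero $f$ is written in normal words; $\bar f$ is its leading associative word, and $f$ is monic if the coefficient of $[\bar f]$ is $1$. $wD^i$ denotes $w$ with $D^i$ applied to its last letter. For a set $S$ of monic elements, a normal $S$-word is $[u\langle m\rangle s\langle m'\rangle v]$ ($s\in S$ $D$-free) or $[u\langle m\rangle D^is]$ ($s\in S$, $i\in\mathbb Z_{\ge 0}^n$), right-normed, where $u,v$ are normal words, possibly absent, $u$ is $D$-free and $m,m'\prec N$; its associative word is $u\langle m\rangle\bar s\langle m'\rangle v$, respectively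 $u\langle m\rangle\bar sD^i$. The compositions of $f,g\in S$ are as follows ($u,v$ normal words, possibly absent, $u$ $D$-free): - including: $f-[u\langle m\rangle g\langle m'\rangle v]$, if $g$ is $D$-free and $w=\bar f=u\langle m\rangle\bar g\langle m'\rangle v$; - right including: $D^if-[u\langle m\rangle D^jg]$, if $w=\bar fD^i=u\langle m\rangle\bar gD^j$ and for each $t$ one of $i_t,j_t$ is $0$; - intersection: $[f\langle m\rangle v]-[u\langle m'\rangle g]$, if $f$ is $D$-free, $w=\bar f\langle m\rangle v=u\langle m'\rangle\bar g$ and $|\bar f|+|\bar g|>|w|$; - left multiplication: $b\langle m\rangle f$, $b\in B$, $m\not\prec N$; - right multiplication: $f\langle m\rangle b$, $b\in B$, $m$ arbitrary, if $f$ is not $D$-free. A composition of one of the first three types is trivial if it is a linear combination of normal $S$-words whose associative words are $<w$, and which are $D$-free if $f,g$ are. A composition $h$ of left or right multiplication is trivial if it is $0$ or a linear combination of normal $S$-words of length at most $|\bar h|$, which are $D$-free in the case of right multiplication, and in the case of left multiplication if $f$ is $D$-free. $S$ is a Gröbner–Shirshov basis if all elements of $S$ are monic and all compositions are trivial. The loop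 Lie algebra $L(\mathfrak g)$ is the Lie $2$-conformal algebra $k[D_1,D_2]\otimes\mathfrak g$ whose products $\lfloor m\rfloor$ are the sesquilinear extension of $a\lfloor 0,0\rfloor b=[ab]$, $a\lfloor m\rfloor b=0$ for $m\ne(0,0)$ $(a,b\in\mathfrak g)$. Its universal enveloping associative $2$-conformal algebra with respect to $\{a_i\}$ and $N=(1,1)$ is the quotient of $C(\{a_i\},(1,1),D_1,D_2)$ by the $2$-conformal ideal generated by all $a_i\langle m\rangle a_j-\{a_j\langle m\rangle a_i\}-a_i\lfloor m\rfloor a_j$, $i\ge j$, $m\prec(1,1)$, where $\{b\langle m\rangle a\}=\sum_{s}(-1)^{m+s}\frac{1}{s!}D^{s}(b\langle m+s\rangle a)$. **Statement.** The set $$S=\{a_i\langle 0,0\rangle a_j-a_j\langle 0,0\rangle a_i-[a_ia_j]\;:\;i>j\}\subseteq C(\{a_i\}_{i\in I},(1,1),D_1,D_2)$$ is a Gröbner–Shirshov basis, and the $2$-conformal ideal generated by $S$ is the defining ideal of the universal enveloping algebra of $L(\mathfrak g)$. -/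

import Mathlib

/-- `m ≺ N`: every coordinate of `m` is strictly smaller than that of `N`. A pair of elements has
locality `N` if all its products `⟨m⟩` with `¬ m ≺ N` vanish. -/
def Below {n : ℕ} (m N : Fin n → ℕ) : Prop := ∀ i, m i < N i

/-- An `n`-conformal algebra over `k`: a vector space with bilinear products `⟨m⟩`, `m ∈ ℕⁿ`, and
commuting linear maps `D₁, …, Dₙ`, subject to locality, the Leibniz rule and sesquilinearity.
(For `m i = 0` the right-hand side of `D_mul` is zero, whatever the truncated difference is.) -/
class NConformalAlgebra (k : Type*) (n : ℕ) (C : Type*) [Field k] [AddCommGroup C]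
    [Module k C] where
  mul : (Fin n → ℕ) → C →ₗ[k] C →ₗ[k] C
  D : Fin n → C →ₗ[k] C
  D_comm : ∀ i j a, D i (D j a) = D j (D i a)
  locality : ∀ a b, ∃ N : Fin n → ℕ, ∀ m, ¬ Below m N → mul m a b = 0
  leibniz : ∀ i m a b, D i (mul m a b) = mul m (D i a) b + mul m a (D i b)
  D_mul : ∀ i m a b, mul m (D i a) b = -(m i : k) • mul (m - Pi.single i 1) a b

/-- Associative `n`-conformal algebras. The terms of the sum over `s ∈ ℕⁿ` with `¬ s ≤ m` have
binomial coefficient `0`, hence the sum is over `s ≤ m`. -/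
class AssocNConformalAlgebra (k : Type*) (n : ℕ) (C : Type*) [Field k] [AddCommGroup C]
    [Module k C] extends NConformalAlgebra k n C where
  assoc : ∀ m m' a b c, mul m' (mul m a b) c =
    ∑ s ∈ Finset.Iic m, ((-1 : k) ^ (∑ i, s i) * ((∏ i, (m i).choose (s i) : ℕ) : k)) •
      mul (m - s) a (mul (m' + s) b c)

namespace NConformalAlgebra

variable (k : Type*) {n : ℕ} {C : Type*} [Field k] [AddCommGroup C] [Module k C]

/-- The product `⟨m⟩`, with the field explicit. -/
abbrev cmul [NConformalAlgebra k n C] (m : Fin n → ℕ) : C →ₗ[k] C →ₗ[k] C := mul m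

/-- The derivation `Dᵢ`, with the field explicit. -/
abbrev cD [NConformalAlgebra k n C] (i : Fin n) : C →ₗ[k] C := D i

/-- `D^i = D₁^{i₁} ⋯ Dₙ^{iₙ}`. -/
def Dpow [NConformalAlgebra k n C] (i : Fin n → ℕ) : C →ₗ[k] C :=
  ((List.finRange n).map fun t => (cD k t : Module.End k C) ^ (i t)).prod

/-- The conformal flip `{b⟨m⟩a} = ∑ₛ (-1)^{m+s} D^{(s)} (b⟨m+s⟩a)`, where `D^{(s)} = D^s / s!`.
By locality only finitely many terms are nonzero. -/
noncomputable def flip [NConformalAlgebra k n C] (m : Fin n → ℕ) (b a : C) : C :=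
  ∑ᶠ s : Fin n → ℕ, ((-1 : k) ^ (∑ i, (m i + s i)) * ((∏ i, (s i).factorial : ℕ) : k)⁻¹) •
    Dpow k s (cmul k (m + s) b a)

/-- A subspace that is stable under the derivations and under all products with arbitrary
elements, on both sides. -/
structure IsConformalIdeal (n : ℕ) [NConformalAlgebra k n C] (J : Submodule k C) : Prop where
  D_mem : ∀ (i : Fin n) (x : C), x ∈ J → cD k i x ∈ J
  mul_mem_left : ∀ (m : Fin n → ℕ) (c x : C), x ∈ J → cmul k m c x ∈ J
  mul_mem_right : ∀ (m : Fin n → ℕ) (c x : C), x ∈ J → cmul k m x c ∈ J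

/-- The `n`-conformal ideal generated by a set. -/
def conformalIdeal (n : ℕ) [NConformalAlgebra k n C] (S : Set C) : Submodule k C :=
  sInf {J | S ⊆ (J : Set C) ∧ IsConformalIdeal k n J}

end NConformalAlgebra

/-! ### The free associative `n`-conformal algebra -/

/-- Nonassociative words in `B` with the binary operations `⟨m⟩` and the unary operations `Dᵢ`. -/
inductive ConfTerm (B : Type*) (n : ℕ)
  | gen (b : B)
  | D (i : Fin n) (t : ConfTerm B n)
  | mul (m : Fin n → ℕ) (s t : ConfTerm B n)

namespace ConfTerm

variable (k : Type*) {B : Type*} {n : ℕ} [Field k]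

/-- The linear extension of the operation `Dᵢ` on words. -/
noncomputable def lD (i : Fin n) : (ConfTerm B n →₀ k) →ₗ[k] (ConfTerm B n →₀ k) :=
  Finsupp.lmapDomain k k (ConfTerm.D i)

/-- The bilinear extension of the operation `⟨m⟩` on words. -/
noncomputable def lmul (m : Fin n → ℕ) :
    (ConfTerm B n →₀ k) →ₗ[k] (ConfTerm B n →₀ k) →ₗ[k] (ConfTerm B n →₀ k) :=
  Finsupp.lsum k fun s => LinearMap.toSpanSingleton k _ (Finsupp.lmapDomain k k (ConfTerm.mul m s))

theorem lmul_single (m : Fin n → ℕ) (s t : ConfTerm B n) (r r' : k) :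
    lmul k m (Finsupp.single s r) (Finsupp.single t r') =
      Finsupp.single (mul m s t) (r * r') := by
  simp only [lmul, Finsupp.lsum_single, LinearMap.toSpanSingleton_apply, LinearMap.smul_apply,
    Finsupp.lmapDomain_apply, Finsupp.mapDomain_single, Finsupp.smul_single, smul_eq_mul]

theorem lD_single (i : Fin n) (t : ConfTerm B n) (r : k) :
    lD k i (Finsupp.single t r) = Finsupp.single (D i t) r := by
  simp [lD]

/-- The defining relations of the free associative `n`-conformal algebra on `B` with locality
function `N`. -/
inductive FreeRel (N : B → B → Fin n → ℕ) : (ConfTerm B n →₀ k) → Prop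
  | local_gen (a b : B) (m : Fin n → ℕ) (h : ¬ Below m (N a b)) :
      FreeRel N (lmul k m (Finsupp.single (gen a) 1) (Finsupp.single (gen b) 1))
  | D_comm (i j : Fin n) (x : ConfTerm B n →₀ k) :
      FreeRel N (lD k i (lD k j x) - lD k j (lD k i x))
  | leibniz (i : Fin n) (m : Fin n → ℕ) (x y : ConfTerm B n →₀ k) :
      FreeRel N (lD k i (lmul k m x y) - (lmul k m (lD k i x) y + lmul k m x (lD k i y)))
  | D_mul (i : Fin n) (m : Fin n → ℕ) (x y : ConfTerm B n →₀ k) :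
      FreeRel N (lmul k m (lD k i x) y - -(m i : k) • lmul k (m - Pi.single i 1) x y)
  | assoc (m m' : Fin n → ℕ) (x y z : ConfTerm B n →₀ k) :
      FreeRel N (lmul k m' (lmul k m x y) z -
        ∑ s ∈ Finset.Iic m, ((-1 : k) ^ (∑ i, s i) * ((∏ i, (m i).choose (s i) : ℕ) : k)) •
          lmul k (m - s) x (lmul k (m' + s) y z))

/-- The subspaces that contain the defining relations and are stable under all operations. -/
structure IsFreeIdeal (N : B → B → Fin n → ℕ) (J : Submodule k (ConfTerm B n →₀ k)) : Prop where
  rel_mem : ∀ x, FreeRel k N x → x ∈ J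
  D_mem : ∀ i x, x ∈ J → lD k i x ∈ J
  mul_mem_left : ∀ m c x, x ∈ J → lmul k m c x ∈ J
  mul_mem_right : ∀ m c x, x ∈ J → lmul k m x c ∈ J

/-- The ideal generated by the defining relations. -/
noncomputable def freeIdeal (N : B → B → Fin n → ℕ) : Submodule k (ConfTerm B n →₀ k) :=
  sInf {J | IsFreeIdeal k N J}

theorem isFreeIdeal_freeIdeal (N : B → B → Fin n → ℕ) : IsFreeIdeal k N (freeIdeal k N) where
  rel_mem x hx := Submodule.mem_sInf.2 fun _ hJ => hJ.rel_mem x hx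
  D_mem i x hx := Submodule.mem_sInf.2 fun J hJ => hJ.D_mem i x (Submodule.mem_sInf.1 hx J hJ)
  mul_mem_left m c x hx :=
    Submodule.mem_sInf.2 fun J hJ => hJ.mul_mem_left m c x (Submodule.mem_sInf.1 hx J hJ)
  mul_mem_right m c x hx :=
    Submodule.mem_sInf.2 fun J hJ => hJ.mul_mem_right m c x (Submodule.mem_sInf.1 hx J hJ)

end ConfTerm

/-- The free associative `n`-conformal algebra `C(B, N, D₁, …, Dₙ)`. -/
abbrev FreeConf (k : Type*) {B : Type*} {n : ℕ} [Field k] (N : B → B → Fin n → ℕ) : Type _ :=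
  (ConfTerm B n →₀ k) ⧸ ConfTerm.freeIdeal k N

namespace FreeConf

open ConfTerm

variable (k : Type*) {B : Type*} {n : ℕ} [Field k] (N : B → B → Fin n → ℕ)

/-- The generators. -/
noncomputable def gen (b : B) : FreeConf k N :=
  (freeIdeal k N).mkQ (Finsupp.single (ConfTerm.gen b) 1)

/-- The derivations on the quotient. -/
noncomputable def qD (i : Fin n) : FreeConf k N →ₗ[k] FreeConf k N :=
  (freeIdeal k N).mapQ (freeIdeal k N) (lD k i) fun x hx =>
    (isFreeIdeal_freeIdeal k N).D_mem i x hx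

/-- The products on the quotient. -/
noncomputable def qmul (m : Fin n → ℕ) : FreeConf k N →ₗ[k] FreeConf k N →ₗ[k] FreeConf k N :=
  (freeIdeal k N).liftQ
    { toFun := fun x => (freeIdeal k N).mapQ (freeIdeal k N) (lmul k m x) fun y hy =>
        (isFreeIdeal_freeIdeal k N).mul_mem_left m x y hy
      map_add' := fun x y => by
        refine Submodule.linearMap_qext _ (LinearMap.ext fun z => ?_)
        simp
      map_smul' := fun c x => by
        refine Submodule.linearMap_qext _ (LinearMap.ext fun z => ?_)
        simp }
    (fun x hx => by
      refine Submodule.linearMap_qext _ (LinearMap.ext fun z => ?_)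
      simpa using (isFreeIdeal_freeIdeal k N).mul_mem_right m z x hx)

theorem mk_D (i : Fin n) (x : ConfTerm B n →₀ k) :
    qD k N i ((freeIdeal k N).mkQ x) = (freeIdeal k N).mkQ (lD k i x) := rfl

theorem mk_mul (m : Fin n → ℕ) (x y : ConfTerm B n →₀ k) :
    qmul k N m ((freeIdeal k N).mkQ x) ((freeIdeal k N).mkQ y) =
      (freeIdeal k N).mkQ (lmul k m x y) := rfl

theorem mk_eq_of_rel {x y : ConfTerm B n →₀ k} (h : FreeRel k N (x - y)) :
    (freeIdeal k N).mkQ x = (freeIdeal k N).mkQ y := by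
  rw [← sub_eq_zero, ← map_sub]
  exact (Submodule.Quotient.mk_eq_zero _).2 ((isFreeIdeal_freeIdeal k N).rel_mem _ h)

theorem qD_comm (i j : Fin n) (a : FreeConf k N) :
    qD k N i (qD k N j a) = qD k N j (qD k N i a) := by
  obtain ⟨x, rfl⟩ := (freeIdeal k N).mkQ_surjective a
  exact mk_eq_of_rel k N (.D_comm i j x)

theorem qleibniz (i : Fin n) (m : Fin n → ℕ) (a b : FreeConf k N) :
    qD k N i (qmul k N m a b) = qmul k N m (qD k N i a) b + qmul k N m a (qD k N i b) := by
  obtain ⟨x, rfl⟩ := (freeIdeal k N).mkQ_surjective a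
  obtain ⟨y, rfl⟩ := (freeIdeal k N).mkQ_surjective b
  simp only [mk_D, mk_mul, ← map_add]
  exact mk_eq_of_rel k N (.leibniz i m x y)

theorem qD_mul (i : Fin n) (m : Fin n → ℕ) (a b : FreeConf k N) :
    qmul k N m (qD k N i a) b = -(m i : k) • qmul k N (m - Pi.single i 1) a b := by
  obtain ⟨x, rfl⟩ := (freeIdeal k N).mkQ_surjective a
  obtain ⟨y, rfl⟩ := (freeIdeal k N).mkQ_surjective b
  simp only [mk_D, mk_mul, ← map_smul (freeIdeal k N).mkQ]
  exact mk_eq_of_rel k N (.D_mul i m x y)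

theorem qassoc (m m' : Fin n → ℕ) (a b c : FreeConf k N) :
    qmul k N m' (qmul k N m a b) c =
      ∑ s ∈ Finset.Iic m, ((-1 : k) ^ (∑ i, s i) * ((∏ i, (m i).choose (s i) : ℕ) : k)) •
        qmul k N (m - s) a (qmul k N (m' + s) b c) := by
  obtain ⟨x, rfl⟩ := (freeIdeal k N).mkQ_surjective a
  obtain ⟨y, rfl⟩ := (freeIdeal k N).mkQ_surjective b
  obtain ⟨z, rfl⟩ := (freeIdeal k N).mkQ_surjective c
  simp only [mk_mul, ← map_smul (freeIdeal k N).mkQ, ← map_sum (freeIdeal k N).mkQ]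
  exact mk_eq_of_rel k N (.assoc m m' x y z)

theorem qmul_gen (a b : B) (m : Fin n → ℕ) (h : ¬ Below m (N a b)) :
    qmul k N m (gen k N a) (gen k N b) = 0 := by
  rw [gen, gen, mk_mul]
  refine (mk_eq_of_rel k N (y := 0) ?_).trans (map_zero _)
  rw [sub_zero]
  exact .local_gen a b m h

/-- All products `a⟨m⟩b` with some coordinate of `m` at least `M` vanish. -/
def Loc (M : ℕ) (a b : FreeConf k N) : Prop := ∀ m, (∃ i, M ≤ m i) → qmul k N m a b = 0

variable {k N}

theorem Loc.mono {M M' : ℕ} (h : M ≤ M') {a b : FreeConf k N} (H : Loc k N M a b) :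
    Loc k N M' a b := fun m ⟨i, hi⟩ => H m ⟨i, h.trans hi⟩

theorem Loc.D_left {M : ℕ} {a b : FreeConf k N} (H : Loc k N M a b) (j : Fin n) :
    Loc k N (M + 1) (qD k N j a) b := fun m ⟨i, hi⟩ => by
  rw [qD_mul, H, smul_zero]
  refine ⟨i, ?_⟩
  have : (Pi.single j 1 : Fin n → ℕ) i ≤ 1 := by
    by_cases hij : i = j
    · subst hij; simp
    · simp [hij]
  simp only [Pi.sub_apply]
  omega

theorem Loc.D_right {M : ℕ} {a b : FreeConf k N} (H : Loc k N M a b) (j : Fin n) :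
    Loc k N (M + 1) a (qD k N j b) := fun m hm => by
  have h := qleibniz k N j m a b
  rw [H.mono (Nat.le_succ M) m hm, H.D_left j m hm, map_zero, zero_add] at h
  exact h.symm

theorem Loc.mul_left {M : ℕ} {b c : FreeConf k N} (H : Loc k N M b c) (p : Fin n → ℕ)
    (a : FreeConf k N) : Loc k N M (qmul k N p a b) c := fun m ⟨i, hi⟩ => by
  rw [qassoc]
  refine Finset.sum_eq_zero fun s _ => ?_
  rw [H (m + s) ⟨i, by simp only [Pi.add_apply]; omega⟩, map_zero, smul_zero]

theorem Loc.mul_right {M M' : ℕ} {a b c : FreeConf k N} (H : Loc k N M a b)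
    (H' : Loc k N M' b c) (p : Fin n → ℕ) : Loc k N (M + M') a (qmul k N p b c) := by
  have key : ∀ (i : Fin n) (L : ℕ) (m p : Fin n → ℕ), ∑ t, m t = L → M + M' ≤ m i + p i →
      qmul k N m a (qmul k N p b c) = 0 := by
    intro i L
    induction L using Nat.strong_induction_on with
    | _ L ih =>
      intro m p hL hi
      by_cases hm : M ≤ m i
      · have h := qassoc k N m p a b c
        rw [H m ⟨i, hm⟩, map_zero, LinearMap.zero_apply,
          Finset.sum_eq_single_of_mem 0 (by simp)] at h
        · simpa using h.symm
        · intro s hs hs0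
          have hsm : s ≤ m := Finset.mem_Iic.1 hs
          rw [ih (∑ t, (m - s) t) ?_ (m - s) (p + s) rfl ?_, smul_zero]
          · rw [← hL]
            obtain ⟨t, ht⟩ := Function.ne_iff.1 hs0
            refine Finset.sum_lt_sum (fun t _ => Nat.sub_le _ _) ⟨t, Finset.mem_univ _, ?_⟩
            have := hsm t
            simp only [Pi.zero_apply, Pi.sub_apply] at *
            omega
          · have := hsm i
            simp only [Pi.add_apply, Pi.sub_apply]
            omega
      · rw [H' p ⟨i, by omega⟩, map_zero]
  exact fun m ⟨i, hi⟩ => key i _ m p rfl (by omega)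

theorem exists_loc_single (s t : ConfTerm B n) :
    ∃ M, Loc k N M ((freeIdeal k N).mkQ (Finsupp.single s 1))
      ((freeIdeal k N).mkQ (Finsupp.single t 1)) := by
  have hD : ∀ i (t : ConfTerm B n), (freeIdeal k N).mkQ (Finsupp.single (ConfTerm.D i t) 1) =
      qD k N i ((freeIdeal k N).mkQ (Finsupp.single t 1)) := by
    intro i t; rw [mk_D, lD_single]
  have hm : ∀ m (s t : ConfTerm B n), (freeIdeal k N).mkQ (Finsupp.single (ConfTerm.mul m s t) 1) =
      qmul k N m ((freeIdeal k N).mkQ (Finsupp.single s 1))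
        ((freeIdeal k N).mkQ (Finsupp.single t 1)) := by
    intro m s t; rw [mk_mul, lmul_single, one_mul]
  induction t generalizing s with
  | D i t ih =>
    obtain ⟨M, hM⟩ := ih s
    exact ⟨M + 1, hD i t ▸ hM.D_right i⟩
  | mul p b c ihb ihc =>
    obtain ⟨M, hM⟩ := ihb s
    obtain ⟨M', hM'⟩ := ihc b
    exact ⟨M + M', hm p b c ▸ hM.mul_right hM' p⟩
  | gen b =>
    induction s with
    | gen a =>
      refine ⟨∑ i, N a b i, fun m ⟨i, hi⟩ => qmul_gen k N a b m fun h => ?_⟩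
      have := Finset.single_le_sum (f := N a b) (fun _ _ => Nat.zero_le _) (Finset.mem_univ i)
      exact absurd (h i) (by omega)
    | D i s ih =>
      obtain ⟨M, hM⟩ := ih
      exact ⟨M + 1, hD i s ▸ hM.D_left i⟩
    | mul p a c _ ihc =>
      obtain ⟨M, hM⟩ := ihc
      exact ⟨M, hm p a c ▸ hM.mul_left p _⟩

theorem exists_loc (a b : FreeConf k N) : ∃ M, Loc k N M a b := by
  obtain ⟨x, rfl⟩ := (freeIdeal k N).mkQ_surjective a
  obtain ⟨y, rfl⟩ := (freeIdeal k N).mkQ_surjective b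
  induction x using Finsupp.induction_linear with
  | zero => exact ⟨0, fun m _ => by simp⟩
  | add x x' hx hx' =>
    obtain ⟨M, hM⟩ := hx
    obtain ⟨M', hM'⟩ := hx'
    refine ⟨max M M', fun m hm => ?_⟩
    rw [map_add, map_add, LinearMap.add_apply, hM.mono (le_max_left _ _) m hm,
      hM'.mono (le_max_right _ _) m hm, add_zero]
  | single s r =>
    induction y using Finsupp.induction_linear with
    | zero => exact ⟨0, fun m _ => by simp⟩
    | add y y' hy hy' =>
      obtain ⟨M, hM⟩ := hy
      obtain ⟨M', hM'⟩ := hy'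
      refine ⟨max M M', fun m hm => ?_⟩
      rw [map_add, map_add, hM.mono (le_max_left _ _) m hm,
        hM'.mono (le_max_right _ _) m hm, add_zero]
    | single t r' =>
      obtain ⟨M, hM⟩ := exists_loc_single (k := k) (N := N) s t
      refine ⟨M, fun m hm => ?_⟩
      rw [← mul_one r, ← mul_one r', ← smul_eq_mul, ← smul_eq_mul, ← Finsupp.smul_single,
        ← Finsupp.smul_single, map_smul, map_smul, map_smul, LinearMap.smul_apply, map_smul,
        hM m hm, smul_zero, smul_zero]

noncomputable instance : AssocNConformalAlgebra k n (FreeConf k N) where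
  mul := qmul k N
  D := qD k N
  D_comm := qD_comm k N
  locality a b := by
    obtain ⟨M, hM⟩ := exists_loc a b
    refine ⟨fun _ => M, fun m hm => hM m ?_⟩
    simpa [Below] using hm
  leibniz := qleibniz k N
  D_mul := qD_mul k N
  assoc := qassoc k N

/-- The universal property. -/
theorem existsUnique_lift {A : Type*} [AddCommGroup A] [Module k A] [AssocNConformalAlgebra k n A]
    (ε : B → A)
    (hε : ∀ a b (m : Fin n → ℕ), ¬ Below m (N a b) →
      NConformalAlgebra.cmul k m (ε a) (ε b) = 0) :
    ∃! f : FreeConf k N →ₗ[k] A,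
      (∀ (i : Fin n) x, f (NConformalAlgebra.cD k i x) = NConformalAlgebra.cD k i (f x)) ∧
      (∀ (m : Fin n → ℕ) x y, f (NConformalAlgebra.cmul k m x y) =
        NConformalAlgebra.cmul k m (f x) (f y)) ∧
      ∀ b, f (gen k N b) = ε b := by
  let ev : ConfTerm B n → A := fun t => ConfTerm.rec ε
    (fun i _ x => NConformalAlgebra.cD k i x)
    (fun m _ _ x y => NConformalAlgebra.cmul k m x y) t
  let F : (ConfTerm B n →₀ k) →ₗ[k] A := Finsupp.linearCombination k ev
  have FD : ∀ i x, F (lD k i x) = NConformalAlgebra.cD k i (F x) := by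
    intro i x
    induction x using Finsupp.induction_linear with
    | zero => simp
    | add x y hx hy => simp only [map_add, hx, hy]
    | single t r => simp [F, lD_single, ev]
  have Fm : ∀ m x y, F (lmul k m x y) = NConformalAlgebra.cmul k m (F x) (F y) := by
    intro m x y
    induction x using Finsupp.induction_linear with
    | zero => simp
    | add x x' hx hx' => simp only [map_add, LinearMap.add_apply, hx, hx']
    | single s r =>
      induction y using Finsupp.induction_linear with
      | zero => simp
      | add y y' hy hy' => simp only [map_add, hy, hy']
      | single t r' =>
        rw [lmul_single]
        simp only [F, Finsupp.linearCombination_single, map_smul, LinearMap.smul_apply, smul_smul,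
          mul_comm r' r]
        rfl
  have hF : ∀ x ∈ freeIdeal k N, F x = 0 := by
    suffices freeIdeal k N ≤ LinearMap.ker F from fun x hx => this hx
    refine sInf_le ⟨fun x hx => ?_, fun i x hx => ?_, fun m c x hx => ?_, fun m c x hx => ?_⟩
    · rw [LinearMap.mem_ker]
      cases hx with
      | local_gen a b m h => rw [Fm]; simpa [F, ev] using hε a b m h
      | D_comm i j x => rw [map_sub, FD, FD, FD, FD, NConformalAlgebra.D_comm, sub_self]
      | leibniz i m x y =>
        rw [map_sub, map_add, FD, Fm, Fm, Fm, FD, FD, NConformalAlgebra.leibniz, sub_self]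
      | D_mul i m x y =>
        rw [map_sub, map_smul, Fm, FD, Fm, NConformalAlgebra.D_mul, sub_self]
      | assoc m m' x y z =>
        simp only [map_sub, map_sum, map_smul, Fm]
        rw [AssocNConformalAlgebra.assoc, sub_self]
    · rw [LinearMap.mem_ker] at *; rw [FD, hx, map_zero]
    · rw [LinearMap.mem_ker] at *; rw [Fm, hx, map_zero]
    · rw [LinearMap.mem_ker] at *; rw [Fm, hx, map_zero, LinearMap.zero_apply]
  refine ⟨(freeIdeal k N).liftQ F hF, ⟨fun i x => ?_, fun m x y => ?_, fun b => ?_⟩, ?_⟩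
  · obtain ⟨x, rfl⟩ := (freeIdeal k N).mkQ_surjective x
    exact FD i x
  · obtain ⟨x, rfl⟩ := (freeIdeal k N).mkQ_surjective x
    obtain ⟨y, rfl⟩ := (freeIdeal k N).mkQ_surjective y
    exact Fm m x y
  · exact (Finsupp.linearCombination_single k (1 : k) (ConfTerm.gen b)).trans (one_smul k _)
  · rintro f ⟨fD, fm, fg⟩
    refine Submodule.linearMap_qext _ (Finsupp.lhom_ext' fun t => LinearMap.ext_ring ?_)
    change f ((freeIdeal k N).mkQ (Finsupp.single t 1)) = F (Finsupp.single t 1)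
    induction t with
    | gen b => rw [show F (Finsupp.single (ConfTerm.gen b) 1) = ε b by simp [F, ev]]; exact fg b
    | D i t ih =>
      have h := fD i ((freeIdeal k N).mkQ (Finsupp.single t 1))
      rw [ih, ← FD] at h
      have e : lD k i (Finsupp.single t 1) = Finsupp.single (ConfTerm.D i t) (1 : k) :=
        lD_single k i t 1
      rw [e] at h
      rw [← h, ← e]; rfl
    | mul m s t ihs iht =>
      have h := fm m ((freeIdeal k N).mkQ (Finsupp.single s 1))
        ((freeIdeal k N).mkQ (Finsupp.single t 1))
      rw [ihs, iht, ← Fm] at h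
      have e : lmul k m (Finsupp.single s 1) (Finsupp.single t 1) =
          Finsupp.single (ConfTerm.mul m s t) (1 : k) := by
        rw [lmul_single, one_mul]
      rw [e] at h
      rw [← h, ← e]; rfl

end FreeConf

/-! ### The loop Lie `n`-conformal algebra and its universal enveloping algebra -/

namespace LoopLie

/-- The factor `m! \binom{j}{m-i}` (zero for `m < i`), in one variable. -/
def coefOne (i j m : ℕ) : ℕ := if i ≤ m then m.factorial * j.choose (m - i) else 0

variable (k : Type*) {n : ℕ} {g : Type*} [Field k] [LieRing g] [LieAlgebra k g]

/-- The coefficient of `D^{i+j-m} [a b]` in `(D^i a)⌊m⌋(D^j b)`. -/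
def coef (i j m : Fin n → ℕ) : k := (-1) ^ (∑ t, i t) * ((∏ t, coefOne (i t) (j t) (m t) : ℕ) : k)

/-- The products of the loop Lie `n`-conformal algebra `k[D₁, …, Dₙ] ⊗ g`, whose elements
`∑ D^i ⊗ xᵢ` are stored as the finitely supported families `i ↦ xᵢ`. They are the sesquilinear
extension of `a⌊0⌋b = [a b]`, `a⌊m⌋b = 0` for `m ≠ 0` (`a, b ∈ g`), which reads
`(D^i a)⌊m⌋(D^j b) = (-1)^i m! \binom{j}{m-i} D^{i+j-m} [a b]`. -/
noncomputable def bracket (m : Fin n → ℕ) :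
    ((Fin n → ℕ) →₀ g) →ₗ[k] ((Fin n → ℕ) →₀ g) →ₗ[k] ((Fin n → ℕ) →₀ g) :=
  Finsupp.lsum k fun i => LinearMap.flip <| Finsupp.lsum k fun j => LinearMap.flip <|
    (LieModule.toEnd k g g : g →ₗ[k] g →ₗ[k] g).compr₂
      (coef k i j m • Finsupp.lsingle (i + j - m))

theorem bracket_single (m i j : Fin n → ℕ) (a b : g) :
    bracket k m (Finsupp.single i a) (Finsupp.single j b) =
      Finsupp.single (i + j - m) (coef k i j m • ⁅a, b⁆) := by
  simp [bracket]

/-- Multiplication by `Dₜ`. -/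
noncomputable def deriv (t : Fin n) : ((Fin n → ℕ) →₀ g) →ₗ[k] ((Fin n → ℕ) →₀ g) :=
  Finsupp.lmapDomain g k fun i => i + Pi.single t 1

theorem deriv_single (t : Fin n) (i : Fin n → ℕ) (a : g) :
    deriv k t (Finsupp.single i a) = Finsupp.single (i + Pi.single t 1) a := by
  simp [deriv]

theorem coefOne_succ (i j m : ℕ) :
    (coefOne i j m : ℤ) = -coefOne (i + 1) j m + coefOne i (j + 1) m := by
  unfold coefOne
  rcases lt_trichotomy i m with h | h | h
  · obtain ⟨r, rfl⟩ := Nat.exists_eq_add_of_lt h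
    have h1 : i + r + 1 - i = r + 1 := by omega
    have h2 : i + r + 1 - (i + 1) = r := by omega
    rw [if_pos (by omega), if_pos (by omega), if_pos (by omega), h1, h2, Nat.choose_succ_succ]
    push_cast
    ring
  · subst h
    simp
  · rw [if_neg (by omega), if_neg (by omega), if_neg (by omega)]
    simp

theorem coefOne_mul (i j m : ℕ) : coefOne (i + 1) j m = m * coefOne i j (m - 1) := by
  unfold coefOne
  cases m with
  | zero => simp
  | succ m =>
    by_cases h : i ≤ m
    · rw [if_pos (by omega), if_pos (by omega), Nat.factorial_succ, mul_assoc]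
      congr 3
      omega
    · rw [if_neg (by omega), if_neg (by omega), mul_zero]

theorem coefOne_eq_zero {i j m : ℕ} (h : i + j < m) : coefOne i j m = 0 := by
  unfold coefOne
  rw [if_pos (by omega), Nat.choose_eq_zero_of_lt (by omega), mul_zero]

theorem coef_eq_zero {i j m : Fin n → ℕ} (t : Fin n) (h : i t + j t < m t) : coef k i j m = 0 := by
  unfold coef
  rw [Finset.prod_eq_zero (Finset.mem_univ t) (coefOne_eq_zero h), Nat.cast_zero, mul_zero]

theorem prod_add_single (F : Fin n → ℕ → ℕ) (i : Fin n → ℕ) (t : Fin n) :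
    ∏ u, F u ((i + Pi.single t 1 : Fin n → ℕ) u) = F t (i t + 1) * ∏ u ∈ Finset.univ.erase t, F u (i u) := by
  rw [← Finset.mul_prod_erase _ _ (Finset.mem_univ t)]
  congr 1
  · simp
  · refine Finset.prod_congr rfl fun u hu => ?_
    simp [Finset.ne_of_mem_erase hu]

theorem sum_add_single (i : Fin n → ℕ) (t : Fin n) :
    ∑ u, (i + Pi.single t 1 : Fin n → ℕ) u = ∑ u, i u + 1 := by
  simp [Finset.sum_add_distrib]

theorem coef_leibniz (t : Fin n) (i j m : Fin n → ℕ) :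
    coef k i j m = coef k (i + Pi.single t 1) j m + coef k i (j + Pi.single t 1) m := by
  unfold coef
  rw [sum_add_single, prod_add_single (fun u x => coefOne x (j u) (m u)),
    prod_add_single (fun u x => coefOne (i u) x (m u)),
    ← Finset.mul_prod_erase _ _ (Finset.mem_univ t)]
  have h := congrArg (Int.cast : ℤ → k) (coefOne_succ (i t) (j t) (m t))
  push_cast at h ⊢
  rw [h]
  ring

theorem coef_D_mul (t : Fin n) (i j m : Fin n → ℕ) :
    coef k (i + Pi.single t 1) j m = -(m t : k) * coef k i j (m - Pi.single t 1) := by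
  unfold coef
  have h := Finset.mul_prod_erase Finset.univ
    (fun u => coefOne (i u) (j u) ((m - Pi.single t 1 : Fin n → ℕ) u)) (Finset.mem_univ t)
  have h' : ∏ u ∈ Finset.univ.erase t, coefOne (i u) (j u) ((m - Pi.single t 1 : Fin n → ℕ) u) =
      ∏ u ∈ Finset.univ.erase t, coefOne (i u) (j u) (m u) :=
    Finset.prod_congr rfl fun u hu => by simp [Finset.ne_of_mem_erase hu]
  have h'' : (m - Pi.single t 1 : Fin n → ℕ) t = m t - 1 := by simp
  rw [h', h''] at h
  rw [sum_add_single, prod_add_single (fun u x => coefOne x (j u) (m u)), coefOne_mul, ← h]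
  push_cast
  ring

theorem leibniz_single (t : Fin n) (m i j : Fin n → ℕ) (a b : g) :
    deriv k t (bracket k m (Finsupp.single i a) (Finsupp.single j b)) =
      bracket k m (deriv k t (Finsupp.single i a)) (Finsupp.single j b) +
        bracket k m (Finsupp.single i a) (deriv k t (Finsupp.single j b)) := by
  simp only [bracket_single, deriv_single]
  rw [show i + (j + Pi.single t 1) - m = i + Pi.single t 1 + j - m by congr 1; abel,
    ← Finsupp.single_add, ← add_smul, ← coef_leibniz]
  by_cases h : m ≤ i + j
  · congr 1
    ext u
    have := h u
    simp only [Pi.add_apply, Pi.sub_apply] at *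
    omega
  · obtain ⟨u, hu⟩ := not_forall.1 h
    rw [coef_eq_zero k u (by simpa using hu)]
    simp

theorem D_mul_single (t : Fin n) (m i j : Fin n → ℕ) (a b : g) :
    bracket k m (deriv k t (Finsupp.single i a)) (Finsupp.single j b) =
      -(m t : k) • bracket k (m - Pi.single t 1) (Finsupp.single i a) (Finsupp.single j b) := by
  simp only [bracket_single, deriv_single]
  rw [coef_D_mul, Finsupp.smul_single, mul_smul]
  by_cases h : m t = 0
  · simp [h]
  · congr 1
    ext u
    by_cases hu : u = t
    · subst hu
      simp
      omega
    · simp [hu]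

noncomputable instance : NConformalAlgebra k n ((Fin n → ℕ) →₀ g) where
  mul := bracket k
  D := deriv k
  D_comm i j a := by
    induction a using Finsupp.induction_linear with
    | zero => simp
    | add x y hx hy => simp only [map_add, hx, hy]
    | single s x => simp only [deriv_single]; rw [add_right_comm]
  locality a b := by
    suffices ∃ M : ℕ, ∀ m : Fin n → ℕ, (∃ t, M ≤ m t) → bracket k m a b = 0 by
      obtain ⟨M, hM⟩ := this
      exact ⟨fun _ => M, fun m hm => hM m (by simpa [Below] using hm)⟩
    induction a using Finsupp.induction_linear with
    | zero => exact ⟨0, fun m _ => by simp⟩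
    | add x x' hx hx' =>
      obtain ⟨M, hM⟩ := hx
      obtain ⟨M', hM'⟩ := hx'
      refine ⟨max M M', fun m ⟨t, ht⟩ => ?_⟩
      rw [map_add, LinearMap.add_apply, hM m ⟨t, (le_max_left _ _).trans ht⟩,
        hM' m ⟨t, (le_max_right _ _).trans ht⟩, add_zero]
    | single i x =>
      induction b using Finsupp.induction_linear with
      | zero => exact ⟨0, fun m _ => by simp⟩
      | add y y' hy hy' =>
        obtain ⟨M, hM⟩ := hy
        obtain ⟨M', hM'⟩ := hy'
        refine ⟨max M M', fun m ⟨t, ht⟩ => ?_⟩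
        rw [map_add, hM m ⟨t, (le_max_left _ _).trans ht⟩,
          hM' m ⟨t, (le_max_right _ _).trans ht⟩, add_zero]
      | single j y =>
        refine ⟨∑ t, (i t + j t) + 1, fun m ⟨t, ht⟩ => ?_⟩
        have := Finset.single_le_sum (f := fun t => i t + j t) (fun _ _ => Nat.zero_le _)
          (Finset.mem_univ t)
        rw [bracket_single, coef_eq_zero k t (by omega)]
        simp
  leibniz t m a b := by
    induction a using Finsupp.induction_linear with
    | zero => simp
    | add x y hx hy => simp only [map_add, LinearMap.add_apply, hx, hy]; abel
    | single i x =>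
      induction b using Finsupp.induction_linear with
      | zero => simp
      | add x y hx hy => simp only [map_add, hx, hy]; abel
      | single j y => exact leibniz_single k t m i j x y
  D_mul t m a b := by
    induction a using Finsupp.induction_linear with
    | zero => simp
    | add x y hx hy => simp only [map_add, LinearMap.add_apply, hx, hy, smul_add]
    | single i x =>
      induction b using Finsupp.induction_linear with
      | zero => simp
      | add x y hx hy => simp only [map_add, hx, hy, smul_add]
      | single j y => exact D_mul_single k t m i j x y

end LoopLie

namespace LoopLie

open NConformalAlgebra

variable {k : Type*} (n : ℕ) {g ι : Type*} [Field k] [LieRing g] [LieAlgebra k g]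

/-- The element `b = 1 ⊗ b` of the loop algebra. -/
noncomputable def of (b : g) : (Fin n → ℕ) →₀ g := Finsupp.single 0 b

/-- The locality function `N(aᵢ, aⱼ) = (1, …, 1)`. -/
abbrev oneLoc (n : ℕ) (ι : Type*) : ι → ι → Fin n → ℕ := fun _ _ _ => 1

/-- An element `∑ αᵢ(D₁, …, Dₙ) aᵢ` of the loop algebra, written in the `k[D₁, …, Dₙ]`-basis
`(aᵢ)`, read as an element of the free associative `n`-conformal algebra on the `aᵢ`. -/
noncomputable def toFree (a : Module.Basis ι k g) :
    ((Fin n → ℕ) →₀ g) →ₗ[k] FreeConf k (oneLoc n ι) :=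
  Finsupp.lsum k fun i => Dpow k i ∘ₗ a.constr k (FreeConf.gen k (oneLoc n ι))

/-- The defining relations
`aᵢ⟨m⟩aⱼ - {aⱼ⟨m⟩aᵢ} - aᵢ⌊m⌋aⱼ`, `i ≥ j`, `m ≺ N = (1, …, 1)`, of the universal enveloping
associative `n`-conformal algebra of the loop algebra. -/
def envelopingRelations [LinearOrder ι] (a : Module.Basis ι k g) :
    Set (FreeConf k (oneLoc n ι)) :=
  {x | ∃ (i j : ι) (m : Fin n → ℕ), j ≤ i ∧ Below m (fun _ => 1) ∧
    x = cmul k m (FreeConf.gen k _ i) (FreeConf.gen k _ j)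
      - NConformalAlgebra.flip k m (FreeConf.gen k _ j) (FreeConf.gen k _ i)
      - toFree n a (cmul k m (of n (a i)) (of n (a j)))}

/-- The ideal of the universal enveloping algebra `U_N(L(g)) = C(B, N) / envelopingIdeal`. -/
noncomputable def envelopingIdeal [LinearOrder ι] (a : Module.Basis ι k g) :
    Submodule k (FreeConf k (oneLoc n ι)) :=
  conformalIdeal k n (envelopingRelations n a)

/-- The elements `aᵢ⟨0⟩aⱼ - aⱼ⟨0⟩aᵢ - [aᵢ aⱼ]`, `i > j`, where `[aᵢ aⱼ]` is expanded in the
basis `(aᵢ)`. -/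
def commutatorRelations [LinearOrder ι] (a : Module.Basis ι k g) :
    Set (FreeConf k (oneLoc n ι)) :=
  {x | ∃ i j : ι, j < i ∧
    x = cmul k (0 : Fin n → ℕ) (FreeConf.gen k _ i) (FreeConf.gen k _ j)
      - cmul k (0 : Fin n → ℕ) (FreeConf.gen k _ j) (FreeConf.gen k _ i)
      - a.constr k (FreeConf.gen k (oneLoc n ι)) ⁅a i, a j⁆}

end LoopLie

/-! ### Gröbner–Shirshov bases -/

/-- The associative word `a₁⟨m₁⟩a₂⟨m₂⟩ ⋯ aₖ⟨mₖ⟩D^i b`, stored as the list of the pairs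
`(aⱼ, mⱼ)`, the letter `b` and the index `i`. -/
@[ext] structure ConfWord (B : Type*) (n : ℕ) where
  pre : List (B × (Fin n → ℕ))
  last : B
  ind : Fin n → ℕ

namespace ConfWord

variable {B : Type*} {n : ℕ}

/-- Normality of a prefix `a₁⟨m₁⟩ ⋯ aₖ⟨mₖ⟩`: every `mⱼ ≺ N`. -/
def PreNormal (N : Fin n → ℕ) (u : List (B × (Fin n → ℕ))) : Prop := ∀ l ∈ u, Below l.2 N

def Normal (N : Fin n → ℕ) (w : ConfWord B n) : Prop := PreNormal N w.pre

def length (w : ConfWord B n) : ℕ := w.pre.length + 1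

/-- The word with the entries `a₁, m₁, …, aₖ, mₖ, b, i`, in pairs. -/
def letters (w : ConfWord B n) : List (B × (Fin n → ℕ)) := w.pre ++ [(w.last, w.ind)]

/-- Lexicographic order of pairs; vectors are compared lexicographically. -/
def letterLT [LinearOrder B] (x y : B × (Fin n → ℕ)) : Prop :=
  x.1 < y.1 ∨ x.1 = y.1 ∧ toLex x.2 < toLex y.2

/-- Lexicographic order of the weights `(|u|, a₁, m₁, …, aₖ, mₖ, b, i)`. -/
instance [LinearOrder B] : LT (ConfWord B n) where
  lt v w := v.length < w.length ∨ v.length = w.length ∧ List.Lex letterLT v.letters w.letters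

/-- `u w` for a prefix `u = a₁⟨m₁⟩ ⋯ aₖ⟨mₖ⟩`. -/
def prepend (u : List (B × (Fin n → ℕ))) (w : ConfWord B n) : ConfWord B n :=
  { w with pre := u ++ w.pre }

/-- `w⟨m⟩v`, used for words `w` of index `0`; the suffix `⟨m⟩v` may be empty. -/
def append (w : ConfWord B n) : Option ((Fin n → ℕ) × ConfWord B n) → ConfWord B n
  | none => w
  | some (m, v) => ⟨w.pre ++ (w.last, m) :: v.pre, v.last, v.ind⟩

/-- `w D^i`, the word `w` with `D^i` applied to its last letter. -/
def appD (w : ConfWord B n) (i : Fin n → ℕ) : ConfWord B n := { w with ind := w.ind + i }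

/-- Normality of a possibly empty suffix `⟨m⟩v`. -/
def SufNormal (N : Fin n → ℕ) (v : Option ((Fin n → ℕ) × ConfWord B n)) : Prop :=
  ∀ p ∈ v, Below p.1 N ∧ p.2.Normal N

end ConfWord

namespace GS

open NConformalAlgebra ConfWord

/-- The free associative `n`-conformal algebra on `B` with constant locality function `N`. -/
abbrev Alg (k : Type*) (B : Type*) {n : ℕ} [Field k] (N : Fin n → ℕ) : Type _ :=
  FreeConf k (fun _ _ : B => N)

variable {k : Type*} {B : Type*} {n : ℕ} [Field k] {N : Fin n → ℕ}

/-- `a₁⟨m₁⟩(a₂⟨m₂⟩(⋯(aₖ⟨mₖ⟩x)))`. -/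
noncomputable def leftMul (u : List (B × (Fin n → ℕ))) (x : Alg k B N) : Alg k B N :=
  u.foldr (fun l y => cmul k l.2 (FreeConf.gen k _ l.1) y) x

/-- The right-normed element `[w]`. -/
noncomputable def eval (w : ConfWord B n) : Alg k B N :=
  leftMul w.pre (Dpow k w.ind (FreeConf.gen k _ w.last))

/-- `x⟨m⟩[v]`; the suffix `⟨m⟩v` may be empty. -/
noncomputable def rightMul (x : Alg k B N) : Option ((Fin n → ℕ) × ConfWord B n) → Alg k B N
  | none => x
  | some (m, v) => cmul k m x (eval v)

/-- `f` is a linear combination of normal words of index `0`. -/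
def DFree (f : Alg k B N) : Prop :=
  f ∈ Submodule.span k {x : Alg k B N | ∃ w : ConfWord B n, w.Normal N ∧ w.ind = 0 ∧ x = eval w}

variable [LinearOrder B]

/-- `w` is the leading word of `f`, with coefficient `α ≠ 0`: `f = α[w] + ∑ αᵢ[uᵢ]` with normal
words `uᵢ < w`. -/
def LeadingWith (α : k) (f : Alg k B N) (w : ConfWord B n) : Prop :=
  α ≠ 0 ∧ w.Normal N ∧
    f - α • eval w ∈ Submodule.span k {x : Alg k B N | ∃ u : ConfWord B n, u.Normal N ∧ u < w ∧ x = eval u}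

/-- `f` is monic with leading word `w`. -/
def MonicLeading (f : Alg k B N) (w : ConfWord B n) : Prop := LeadingWith 1 f w

/-- `NormalSWord S x w`: `x` is a normal `S`-word, of the form `[u s⟨m⟩v]` with `s ∈ S`
`D`-free, or `[u D^i s]` with `s ∈ S`, and `w` is the associative word obtained from it by
replacing `s` with its leading word. The prefix `u` (which ends in some `⟨m⟩`) and the suffix
`⟨m⟩v` may be empty. -/
inductive NormalSWord (S : Set (Alg k B N)) : Alg k B N → ConfWord B n → Prop
  | first (u : List (B × (Fin n → ℕ))) (s : Alg k B N) (p : ConfWord B n)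
      (v : Option ((Fin n → ℕ) × ConfWord B n)) (hs : s ∈ S) (hp : MonicLeading s p)
      (hD : DFree s) (hu : PreNormal N u) (hv : SufNormal N v) :
      NormalSWord S (leftMul u (rightMul s v)) (prepend u (p.append v))
  | second (u : List (B × (Fin n → ℕ))) (i : Fin n → ℕ) (s : Alg k B N) (p : ConfWord B n)
      (hs : s ∈ S) (hp : MonicLeading s p) (hu : PreNormal N u) :
      NormalSWord S (leftMul u (Dpow k i s)) (prepend u (p.appD i))

/-- Triviality of the composition `h = (f, g)_w` modulo `S`: `h` is a linear combination of normal
`S`-words with associative words `< w`, which are `D`-free if `f` and `g` are. -/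
def TrivialMod (S : Set (Alg k B N)) (f g : Alg k B N) (w : ConfWord B n) (h : Alg k B N) : Prop :=
  h ∈ Submodule.span k {x : Alg k B N | ∃ w', NormalSWord S x w' ∧ w' < w ∧
    (DFree f ∧ DFree g → DFree x)}

/-- Triviality modulo `S` of a composition `h` of left or right multiplication: `h` is a linear
combination of normal `S`-words of length at most the length of the leading word of `h`, which
are `D`-free if `P` holds. -/
def TrivialMulMod (S : Set (Alg k B N)) (P : Prop) (h : Alg k B N) : Prop :=
  h = 0 ∨ ∃ (α : k) (w : ConfWord B n), LeadingWith α h w ∧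
    h ∈ Submodule.span k {x : Alg k B N | ∃ w', NormalSWord S x w' ∧ w'.length ≤ w.length ∧
      (P → DFree x)}

/-- A Gröbner–Shirshov basis: a set of monic elements, all of whose compositions are trivial. -/
structure IsGroebnerShirshov (S : Set (Alg k B N)) : Prop where
  monic : ∀ f ∈ S, ∃ w : ConfWord B n, MonicLeading f w
  including : ∀ f ∈ S, ∀ g ∈ S, ∀ p q : ConfWord B n, MonicLeading f p → MonicLeading g q →
    DFree g → ∀ (u : List (B × (Fin n → ℕ))) (v : Option ((Fin n → ℕ) × ConfWord B n)),
    PreNormal N u → SufNormal N v → p = prepend u (q.append v) →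
    TrivialMod S f g p (f - leftMul u (rightMul g v))
  right_including : ∀ f ∈ S, ∀ g ∈ S, ∀ p q : ConfWord B n, MonicLeading f p →
    MonicLeading g q → ∀ (u : List (B × (Fin n → ℕ))) (i j : Fin n → ℕ), PreNormal N u →
    (∀ t, i t = 0 ∨ j t = 0) → p.appD i = prepend u (q.appD j) →
    TrivialMod S f g (p.appD i) (Dpow k i f - leftMul u (Dpow k j g))
  intersection : ∀ f ∈ S, ∀ g ∈ S, ∀ p q : ConfWord B n, MonicLeading f p → MonicLeading g q →
    DFree f → ∀ (u : List (B × (Fin n → ℕ))) (v : Option ((Fin n → ℕ) × ConfWord B n)),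
    PreNormal N u → SufNormal N v → p.append v = prepend u q →
    (p.append v).length < p.length + q.length →
    TrivialMod S f g (p.append v) (rightMul f v - leftMul u g)
  left_mul : ∀ f ∈ S, ∀ (a : B) (m : Fin n → ℕ), ¬ Below m N →
    TrivialMulMod S (DFree f) (cmul k m (FreeConf.gen k _ a) f)
  right_mul : ∀ f ∈ S, ¬ DFree f → ∀ (a : B) (m : Fin n → ℕ),
    TrivialMulMod S True (cmul k m f (FreeConf.gen k _ a))

end GS

/-! For locality `(1, …, 1)` a normal word uses only the product `⟨0⟩`, which is associative in the
ordinary sense. The `D`-free elements therefore behave like noncommutative polynomials in the `aᵢ`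
without constant term, and the relations in `S` are those of the universal enveloping algebra of
`g`. The statement reduces to the Gröbner–Shirshov argument behind the Poincaré–Birkhoff–Witt
theorem.

Every element of `S` is `D`-free with a leading word `aᵢ⟨0⟩aⱼ`, `i > j`, of length two. Inclusions
can only compare a relation with itself. The only genuine overlaps are `aᵢ⟨0⟩aⱼ⟨0⟩aₗ` with `i > j >
l`, and `overlap_identity` resolves them by the Jacobi identity; `overlap_trivial` checks that all
terms are smaller. Left multiplications vanish, since a generator annihilates `D`-free elements in
every product `⟨m⟩`, `m ≠ 0` (`DFree.gen_mul_eq_zero`). Right multiplications do not occur.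

The compositions range over all leading words of the given elements, so leading words must be shown
to be unique. This follows from the linear independence of normal words, which is detected by a
homomorphism to the current algebra of the free associative algebra (`exists_hom_eval`,
`MonicLeading.unique`). To have that homomorphism, current algebras must be associative conformal
algebras: the associativity identity passes to derivatives in each argument, so it only has to be
checked on constants.

For the ideals, locality makes the flip of two generators the opposite product. The enveloping
relations are thus the commutator relations together with the diagonal ones, which are zero. -/

/-! ### Associativity and derivations -/

namespace NConformalAlgebra

open Finset

variable (k : Type*) {n : ℕ} {C : Type*} [Field k] [AddCommGroup C] [Module k C]

/-- The coefficient `(-1)^s \binom{m}{s}`. -/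
def assocCoef (m s : Fin n → ℕ) : k :=
  (-1 : k) ^ (∑ i, s i) * ((∏ i, (m i).choose (s i) : ℕ) : k)

theorem assocCoef_eq_zero {m s : Fin n → ℕ} (h : ¬ s ≤ m) : assocCoef k m s = 0 := by
  obtain ⟨t, ht⟩ := not_forall.1 h
  rw [assocCoef, prod_eq_zero (mem_univ t) (Nat.choose_eq_zero_of_lt (not_le.1 ht)), Nat.cast_zero,
    mul_zero]

/-- This and `assocCoef_add_single` absorb a linear factor into a binomial coefficient: `(m - s)
C(m, s) = m C(m - 1, s)` and `(s + 1) C(m, s + 1) = m C(m - 1, s)` in coordinate `t`. Such factors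
arise from sesquilinearity when one argument of a product is differentiated. -/
theorem assocCoef_mul_sub (t : Fin n) (m s : Fin n → ℕ) :
    assocCoef k m s * ((m t - s t : ℕ) : k) =
      (m t : k) * assocCoef k (m - Pi.single t 1) s := by
  have ht : (m - Pi.single t 1 : Fin n → ℕ) t = m t - 1 := by simp
  have hu : ∀ u ≠ t, (m - Pi.single t 1 : Fin n → ℕ) u = m u := fun u hu => by simp [hu]
  generalize (m - Pi.single t 1 : Fin n → ℕ) = l at ht hu ⊢
  have h : ∏ u ∈ univ.erase t, (l u).choose (s u) = ∏ u ∈ univ.erase t, (m u).choose (s u) :=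
    prod_congr rfl fun u h => by rw [hu u (ne_of_mem_erase h)]
  have h' : (m t).choose (s t) * (m t - s t) = m t * (m t - 1).choose (s t) := by
    cases m t with
    | zero => simp
    | succ r => rw [Nat.add_sub_cancel, ← Nat.choose_mul_succ_eq, mul_comm]
  unfold assocCoef
  rw [← mul_prod_erase univ (fun u => (m u).choose (s u)) (mem_univ t),
    ← mul_prod_erase univ (fun u => (l u).choose (s u)) (mem_univ t), h, ht]
  have h'' := congrArg (Nat.cast : ℕ → k) h'
  rw [Nat.cast_mul, Nat.cast_mul] at h''
  rw [Nat.cast_mul, Nat.cast_mul]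
  linear_combination
    (-1) ^ (∑ i, s i) * ((∏ u ∈ univ.erase t, (m u).choose (s u) : ℕ) : k) * h''

theorem assocCoef_add_single (t : Fin n) (m s : Fin n → ℕ) :
    assocCoef k m (s + Pi.single t 1) * ((s t + 1 : ℕ) : k) =
      -((m t : k) * assocCoef k (m - Pi.single t 1) s) := by
  have ht : (m - Pi.single t 1 : Fin n → ℕ) t = m t - 1 := by simp
  have hu : ∀ u ≠ t, (m - Pi.single t 1 : Fin n → ℕ) u = m u := fun u hu => by simp [hu]
  generalize (m - Pi.single t 1 : Fin n → ℕ) = l at ht hu ⊢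
  have h : ∏ u ∈ univ.erase t, (l u).choose (s u) = ∏ u ∈ univ.erase t, (m u).choose (s u) :=
    prod_congr rfl fun u h => by rw [hu u (ne_of_mem_erase h)]
  have h' : (m t).choose (s t + 1) * (s t + 1) = m t * (m t - 1).choose (s t) := by
    cases m t with
    | zero => simp
    | succ r => exact (Nat.add_one_mul_choose_eq r (s t)).symm
  unfold assocCoef
  rw [LoopLie.sum_add_single, LoopLie.prod_add_single (fun u x => (m u).choose x),
    ← mul_prod_erase univ (fun u => (l u).choose (s u)) (mem_univ t), h, ht]
  have h'' := congrArg (Nat.cast : ℕ → k) h'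
  rw [Nat.cast_mul, Nat.cast_mul] at h''
  rw [Nat.cast_mul, Nat.cast_mul, pow_succ]
  linear_combination
    -(-1) ^ (∑ i, s i) * ((∏ u ∈ univ.erase t, (m u).choose (s u) : ℕ) : k) * h''

/-- The sum `∑ₛ (-1)^s \binom{m}{s} X (m - s) (m' + s)`. -/
def assocSum (m m' : Fin n → ℕ) (X : (Fin n → ℕ) → (Fin n → ℕ) → C) : C :=
  ∑ s ∈ Iic m, assocCoef k m s • X (m - s) (m' + s)

/-- The coefficients vanish outside `Iic m`; enlarging the box lets sums for `m` and for `m -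
Pi.single t 1` be compared termwise. -/
theorem assocSum_eq_sum {m M : Fin n → ℕ} (h : m ≤ M) (m' : Fin n → ℕ)
    (X : (Fin n → ℕ) → (Fin n → ℕ) → C) :
    assocSum k m m' X = ∑ s ∈ Iic M, assocCoef k m s • X (m - s) (m' + s) :=
  sum_subset (Iic_subset_Iic.2 h) fun s _ hs => by
    rw [assocCoef_eq_zero k (by simpa using hs), zero_smul]

theorem assocSum_shift_left (t : Fin n) (m m' : Fin n → ℕ)
    (X : (Fin n → ℕ) → (Fin n → ℕ) → C) :
    assocSum k m m' (fun p q => -(p t : k) • X (p - Pi.single t 1) q) =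
      -(m t : k) • assocSum k (m - Pi.single t 1) m' X := by
  rw [assocSum_eq_sum k (tsub_le_self : m - Pi.single t 1 ≤ m), assocSum, smul_sum]
  refine sum_congr rfl fun s _ => ?_
  rw [smul_smul, smul_smul, Pi.sub_apply, mul_neg, assocCoef_mul_sub, neg_mul, tsub_right_comm]

/-- With `q = m' + s`, the factor `q t` splits into `m' t`, which gives the first summand, and `s
t`, which is absorbed by the binomial coefficient after the shift `s ↦ s + Pi.single t 1`. -/
theorem assocSum_shift_right (t : Fin n) (m m' : Fin n → ℕ)
    (X : (Fin n → ℕ) → (Fin n → ℕ) → C) :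
    assocSum k m m' (fun p q => -(q t : k) • X p (q - Pi.single t 1)) =
      -(m' t : k) • assocSum k m (m' - Pi.single t 1) X +
        (m t : k) • assocSum k (m - Pi.single t 1) m' X := by
  have split : assocSum k m m' (fun p q => -(q t : k) • X p (q - Pi.single t 1)) =
      -(m' t : k) • assocSum k m (m' - Pi.single t 1) X -
        ∑ s ∈ Iic m, (assocCoef k m s * (s t : k)) • X (m - s) (m' + s - Pi.single t 1) := by
    rw [assocSum, assocSum, smul_sum, ← sum_sub_distrib]
    refine sum_congr rfl fun s _ => ?_
    -- For `m' t = 0` the truncated index `m' - Pi.single t 1` is wrong, but it carries the factor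
    -- `0`.
    by_cases h : m' t = 0
    · simp [h, smul_smul]
    · have e : m' - Pi.single t 1 + s = m' + s - Pi.single t 1 := by
        ext u
        by_cases hu : u = t
        · subst hu; simp; omega
        · simp [hu]
      rw [e, smul_smul, smul_smul, ← sub_smul, Pi.add_apply]
      congr 1
      push_cast
      ring
  rw [split, sub_eq_add_neg]
  congr 1
  rw [assocSum_eq_sum k (tsub_le_self : m - Pi.single t 1 ≤ m), smul_sum, ← sum_neg_distrib]
  rw [← sum_filter_add_sum_filter_not (Iic m) (fun s => s t = 0)]
  rw [sum_eq_zero (s := {s ∈ Iic m | s t = 0}), zero_add]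
  swap
  · intro s hs
    simp [(mem_filter.1 hs).2]
  have key : ∀ s : Fin n → ℕ,
      (m t : k) • assocCoef k (m - Pi.single t 1) s • X (m - Pi.single t 1 - s) (m' + s) =
        -((assocCoef k m (s + Pi.single t 1) * ((s + Pi.single t 1 : Fin n → ℕ) t : k)) •
          X (m - (s + Pi.single t 1)) (m' + (s + Pi.single t 1) - Pi.single t 1)) := by
    intro s
    rw [smul_smul, ← add_assoc m', add_tsub_cancel_right, ← neg_smul, tsub_tsub,
      add_comm (Pi.single t 1) s, Pi.add_apply, Pi.single_eq_same, assocCoef_add_single, neg_neg]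
  symm
  -- The shift need not preserve the box `Iic m`; it does so on the nonzero terms, which have `s ≤ m
  -- - Pi.single t 1` and `m t ≠ 0`.
  refine sum_bij_ne_zero (fun s _ _ => s + Pi.single t 1) ?_ ?_ ?_ ?_
  · intro s _ hs0
    have hs : s ≤ m - Pi.single t 1 := by
      by_contra hs
      exact hs0 (by rw [assocCoef_eq_zero k hs, zero_smul, smul_zero])
    have hm : m t ≠ 0 := fun hm => hs0 (by rw [hm, Nat.cast_zero, zero_smul])
    simp only [mem_filter, mem_Iic]
    refine ⟨fun u => ?_, by simp⟩
    have := hs u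
    by_cases hu : u = t
    · subst hu; simp at this ⊢; omega
    · simpa [hu] using this
  · intro s _ _ s' _ _ h
    exact add_right_cancel h
  · intro s hs hs0
    obtain ⟨hs, ht⟩ := mem_filter.1 hs
    have e : s - Pi.single t 1 + Pi.single t 1 = s := by
      refine tsub_add_cancel_of_le fun u => ?_
      by_cases hu : u = t
      · subst hu; simp; omega
      · simp [hu]
    refine ⟨s - Pi.single t 1, mem_Iic.2 (tsub_le_self.trans (mem_Iic.1 hs)), ?_, e⟩
    rwa [key, e]
  · exact fun s _ _ => key s

/-- Associativity of the triple `(a, b, c)`. -/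
def AssocTriple [NConformalAlgebra k n C] (a b c : C) : Prop :=
  ∀ m m' : Fin n → ℕ, cmul k m' (cmul k m a b) c =
    assocSum k m m' fun p q => cmul k p a (cmul k q b c)

variable {k}

/-! ### Associativity is inherited by derivatives and sums -/

section

variable [NConformalAlgebra k n C] {a b c : C}

theorem AssocTriple.D_left (h : AssocTriple (n := n) k a b c) (t : Fin n) :
    AssocTriple (n := n) k (cD k t a) b c := fun m m' => by
  simp only [D_mul]
  rw [assocSum_shift_left k t m m' fun p q => cmul k p a (cmul k q b c), ← h, map_smul,
    LinearMap.smul_apply]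

/-- The Leibniz rule trades the derivative of `b` for derivatives in left arguments, where
sesquilinearity applies. The two resulting terms are those of `assocSum_shift_right`. -/
theorem AssocTriple.D_middle (h : AssocTriple (n := n) k a b c) (t : Fin n) :
    AssocTriple (n := n) k a (cD k t b) c := fun m m' => by
  have e : cmul k m a (cD k t b) = cD k t (cmul k m a b) - cmul k m (cD k t a) b := by
    rw [leibniz, add_sub_cancel_left]
  rw [e]
  simp only [map_sub, LinearMap.sub_apply, D_mul, map_smul, LinearMap.smul_apply]
  rw [assocSum_shift_right k t m m' fun p q => cmul k p a (cmul k q b c), ← h, ← h]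
  simp [sub_neg_eq_add]

/-- Differentiating the associativity identity for `(a, b, c)` yields the sum of the identities with
`D` on `a`, on `b` and on `c`; the first two are already known. -/
theorem AssocTriple.D_right (h : AssocTriple (n := n) k a b c) (t : Fin n) :
    AssocTriple (n := n) k a b (cD k t c) := fun m m' => by
  have e : ∀ (p : Fin n → ℕ) (x y : C), cmul k p x (cD k t y) =
      cD k t (cmul k p x y) - cmul k p (cD k t x) y := fun p x y => by
    rw [leibniz, add_sub_cancel_left]
  have h₁ := h.D_left t m m'
  have h₂ := h.D_middle t m m'
  have h₃ := h m m'
  have e' : cD k t (cmul k m a b) = cmul k m (cD k t a) b + cmul k m a (cD k t b) := leibniz ..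
  rw [e, e', map_add, LinearMap.add_apply, h₁, h₂, h₃]
  simp only [assocSum, map_sum, ← sum_add_distrib, ← sum_sub_distrib, map_smul, ← smul_add,
    ← smul_sub, e, map_sub]
  refine sum_congr rfl fun s _ => ?_
  congr 1
  abel

theorem AssocTriple.add_left {a' : C} (h : AssocTriple (n := n) k a b c)
    (h' : AssocTriple (n := n) k a' b c) : AssocTriple (n := n) k (a + a') b c := fun m m' => by
  simp only [map_add, LinearMap.add_apply, h m m', h' m m', assocSum, ← sum_add_distrib, smul_add]

theorem AssocTriple.add_middle {b' : C} (h : AssocTriple (n := n) k a b c)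
    (h' : AssocTriple (n := n) k a b' c) : AssocTriple (n := n) k a (b + b') c := fun m m' => by
  simp only [map_add, LinearMap.add_apply, h m m', h' m m', assocSum, ← sum_add_distrib, smul_add]

theorem AssocTriple.add_right {c' : C} (h : AssocTriple (n := n) k a b c)
    (h' : AssocTriple (n := n) k a b c') : AssocTriple (n := n) k a b (c + c') := fun m m' => by
  simp only [map_add, h m m', h' m m', assocSum, ← sum_add_distrib, smul_add]

theorem assocTriple_zero_left : AssocTriple (n := n) k 0 b c := fun m m' => by simp [assocSum]

theorem assocTriple_zero_middle : AssocTriple (n := n) k a 0 c := fun m m' => by simp [assocSum]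

theorem assocTriple_zero_right : AssocTriple (n := n) k a b 0 := fun m m' => by simp [assocSum]

end

end NConformalAlgebra

/-! ### Current algebras -/

/-- The current algebra `k[D₁, …, Dₙ] ⊗ A` of an associative algebra `A`, whose elements
`∑ D^i ⊗ xᵢ` are stored as the families `i ↦ xᵢ`. -/
def Cur (n : ℕ) (A : Type*) [Zero A] : Type _ := (Fin n → ℕ) →₀ A

namespace Cur

open NConformalAlgebra

noncomputable instance (n : ℕ) (A : Type*) [AddCommGroup A] : AddCommGroup (Cur n A) :=
  inferInstanceAs (AddCommGroup ((Fin n → ℕ) →₀ A))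

noncomputable instance (k : Type*) [Field k] (n : ℕ) (A : Type*) [AddCommGroup A] [Module k A] :
    Module k (Cur n A) :=
  inferInstanceAs (Module k ((Fin n → ℕ) →₀ A))

/-- The element `D^i ⊗ x`. -/
noncomputable def single {n : ℕ} {A : Type*} [Zero A] (i : Fin n → ℕ) (x : A) : Cur n A :=
  Finsupp.single i x

variable (k : Type*) {n : ℕ} {A : Type*} [Field k] [Ring A] [Algebra k A]

@[elab_as_elim]
theorem induction_linear {P : Cur n A → Prop} (x : Cur n A) (zero : P 0)
    (add : ∀ x y, P x → P y → P (x + y)) (single : ∀ i x, P (single i x)) : P x :=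
  Finsupp.induction_linear x zero add single

theorem single_zero (i : Fin n → ℕ) : single i (0 : A) = 0 := Finsupp.single_zero i

theorem single_add (i : Fin n → ℕ) (x y : A) : single i (x + y) = single i x + single i y :=
  Finsupp.single_add i x y

theorem smul_single (c : k) (i : Fin n → ℕ) (x : A) : c • single i x = single i (c • x) :=
  Finsupp.smul_single c i x

/-- The products `(D^i x)⟨m⟩(D^j y) = (-1)^i m! \binom{j}{m-i} D^{i+j-m} (x y)`, on families. -/
noncomputable def mulFinsupp (m : Fin n → ℕ) :
    ((Fin n → ℕ) →₀ A) →ₗ[k] ((Fin n → ℕ) →₀ A) →ₗ[k] ((Fin n → ℕ) →₀ A) :=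
  Finsupp.lsum k fun i => LinearMap.flip <| Finsupp.lsum k fun j => LinearMap.flip <|
    (LinearMap.mul k A).compr₂ (LoopLie.coef k i j m • Finsupp.lsingle (i + j - m))

theorem mulFinsupp_single (m i j : Fin n → ℕ) (x y : A) :
    mulFinsupp k m (Finsupp.single i x) (Finsupp.single j y) =
      Finsupp.single (i + j - m) (LoopLie.coef k i j m • (x * y)) := by
  simp [mulFinsupp, -Finsupp.single_mul]

/-- The products of the current algebra. -/
noncomputable def mul (m : Fin n → ℕ) : Cur n A →ₗ[k] Cur n A →ₗ[k] Cur n A :=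
  mulFinsupp k m

theorem mul_single (m i j : Fin n → ℕ) (x y : A) :
    mul k m (single i x) (single j y) = single (i + j - m) (LoopLie.coef k i j m • (x * y)) :=
  mulFinsupp_single k m i j x y

/-- Multiplication by `Dₜ`. -/
noncomputable def deriv (t : Fin n) : Cur n A →ₗ[k] Cur n A :=
  (Finsupp.lmapDomain A k fun i => i + Pi.single t 1 :
    ((Fin n → ℕ) →₀ A) →ₗ[k] ((Fin n → ℕ) →₀ A))

theorem deriv_single (t : Fin n) (i : Fin n → ℕ) (x : A) :
    deriv k t (single i x) = single (i + Pi.single t 1) x :=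
  Finsupp.mapDomain_single

theorem leibniz_single (t : Fin n) (m i j : Fin n → ℕ) (a b : A) :
    deriv k t (mul k m (single i a) (single j b)) =
      mul k m (deriv k t (single i a)) (single j b) +
        mul k m (single i a) (deriv k t (single j b)) := by
  simp only [mul_single, deriv_single]
  rw [show i + (j + Pi.single t 1) - m = i + Pi.single t 1 + j - m by congr 1; abel,
    ← single_add, ← add_smul, ← LoopLie.coef_leibniz]
  -- The exponents match when `m ≤ i + j`. Otherwise the subtraction truncates, but the coefficient
  -- is zero.
  by_cases h : m ≤ i + j
  · congr 1
    ext u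
    have := h u
    simp only [Pi.add_apply, Pi.sub_apply] at *
    omega
  · obtain ⟨u, hu⟩ := not_forall.1 h
    rw [LoopLie.coef_eq_zero k u (by simpa using hu)]
    simp [single_zero]

theorem D_mul_single (t : Fin n) (m i j : Fin n → ℕ) (a b : A) :
    mul k m (deriv k t (single i a)) (single j b) =
      -(m t : k) • mul k (m - Pi.single t 1) (single i a) (single j b) := by
  simp only [mul_single, deriv_single]
  rw [LoopLie.coef_D_mul, smul_single, mul_smul]
  by_cases h : m t = 0
  · simp [h, single_zero]
  · congr 1
    ext u
    by_cases hu : u = t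
    · subst hu
      simp
      omega
    · simp [hu]

noncomputable instance : NConformalAlgebra k n (Cur n A) where
  mul := mul k
  D := deriv k
  D_comm i j a := by
    induction a using induction_linear with
    | zero => simp
    | add x y hx hy => simp only [map_add, hx, hy]
    | single s x => simp only [deriv_single]; rw [add_right_comm]
  locality a b := by
    suffices ∃ M : ℕ, ∀ m : Fin n → ℕ, (∃ t, M ≤ m t) → mul k m a b = 0 by
      obtain ⟨M, hM⟩ := this
      exact ⟨fun _ => M, fun m hm => hM m (by simpa [Below] using hm)⟩
    induction a using induction_linear with
    | zero => exact ⟨0, fun m _ => by simp⟩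
    | add x x' hx hx' =>
      obtain ⟨M, hM⟩ := hx
      obtain ⟨M', hM'⟩ := hx'
      refine ⟨max M M', fun m ⟨t, ht⟩ => ?_⟩
      rw [map_add, LinearMap.add_apply, hM m ⟨t, (le_max_left _ _).trans ht⟩,
        hM' m ⟨t, (le_max_right _ _).trans ht⟩, add_zero]
    | single i x =>
      induction b using induction_linear with
      | zero => exact ⟨0, fun m _ => by simp⟩
      | add y y' hy hy' =>
        obtain ⟨M, hM⟩ := hy
        obtain ⟨M', hM'⟩ := hy'
        refine ⟨max M M', fun m ⟨t, ht⟩ => ?_⟩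
        rw [map_add, hM m ⟨t, (le_max_left _ _).trans ht⟩,
          hM' m ⟨t, (le_max_right _ _).trans ht⟩, add_zero]
      | single j y =>
        refine ⟨∑ t, (i t + j t) + 1, fun m ⟨t, ht⟩ => ?_⟩
        have := Finset.single_le_sum (f := fun t => i t + j t) (fun _ _ => Nat.zero_le _)
          (Finset.mem_univ t)
        rw [mul_single, LoopLie.coef_eq_zero k t (by omega), zero_smul, single_zero]
  leibniz t m a b := by
    induction a using induction_linear with
    | zero => simp
    | add x y hx hy => simp only [map_add, LinearMap.add_apply, hx, hy]; abel
    | single i x =>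
      induction b using induction_linear with
      | zero => simp
      | add x y hx hy => simp only [map_add, hx, hy]; abel
      | single j y => exact leibniz_single k t m i j x y
  D_mul t m a b := by
    induction a using induction_linear with
    | zero => simp
    | add x y hx hy => simp only [map_add, LinearMap.add_apply, hx, hy, smul_add]
    | single i x =>
      induction b using induction_linear with
      | zero => simp
      | add x y hx hy => simp only [map_add, hx, hy, smul_add]
      | single j y => exact D_mul_single k t m i j x y

theorem cmul_single (m i j : Fin n → ℕ) (x y : A) :
    cmul (C := Cur n A) k m (single i x) (single j y) = single (i + j - m) (LoopLie.coef k i j m • (x * y)) :=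
  mul_single k m i j x y

theorem cD_single (t : Fin n) (i : Fin n → ℕ) (x : A) :
    cD (C := Cur n A) k t (single i x) = single (i + Pi.single t 1) x :=
  deriv_single k t i x

theorem coef_zero_zero (m : Fin n → ℕ) : LoopLie.coef k 0 0 m = if m = 0 then 1 else 0 := by
  split_ifs with h
  · subst h
    simp [LoopLie.coef, LoopLie.coefOne]
  · obtain ⟨t, ht⟩ := Function.ne_iff.1 h
    exact LoopLie.coef_eq_zero k t (Nat.pos_of_ne_zero ht)

theorem coef_zero_left (j : Fin n → ℕ) : LoopLie.coef k 0 j 0 = 1 := by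
  simp [LoopLie.coef, LoopLie.coefOne]

theorem cmul_zero_single (m : Fin n → ℕ) (x y : A) :
    cmul (C := Cur n A) k m (single 0 x) (single 0 y) = if m = 0 then single 0 (x * y) else 0 := by
  rw [cmul_single, coef_zero_zero]
  split_ifs with h
  · simp [h]
  · simp [single_zero]

/-- Constants multiply nontrivially only for index `0`, so both sides vanish unless `m = m' = 0`,
where the identity is associativity in `A`. -/
theorem assocTriple_zero (x y z : A) :
    AssocTriple (C := Cur n A) (n := n) k (single 0 x) (single 0 y) (single 0 z) := by
  intro m m'
  by_cases hm : m = 0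
  · subst hm
    have : (Finset.Iic (0 : Fin n → ℕ)) = {0} := by ext; simp
    rw [assocSum, this, Finset.sum_singleton]
    simp only [cmul_zero_single, if_true, add_zero, assocCoef, tsub_zero]
    by_cases hm' : m' = 0
    · simp [hm', cmul_zero_single, mul_assoc]
    · simp [hm']
  · rw [cmul_zero_single, if_neg hm, map_zero, LinearMap.zero_apply, assocSum, eq_comm]
    refine Finset.sum_eq_zero fun s _ => ?_
    rw [cmul_zero_single]
    split_ifs with h
    · have hs : s = 0 := (add_eq_zero.1 h).2
      subst hs
      rw [cmul_zero_single, if_neg (by simpa using hm), smul_zero]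
    · rw [map_zero, smul_zero]

/-- To prove a property of `D^i x` it is enough to prove it for `x` and to see that it is
inherited by derivatives. -/
theorem single_induction {P : Cur n A → Prop} {x : A} (h₀ : P (single 0 x))
    (h : ∀ (y : Cur n A) (t : Fin n), P y → P (cD k t y)) (i : Fin n → ℕ) : P (single i x) := by
  induction hL : ∑ t, i t generalizing i with
  | zero =>
    have : i = 0 := funext fun t => Finset.sum_eq_zero_iff.1 hL t (Finset.mem_univ t)
    rwa [this]
  | succ L ih =>
    obtain ⟨t, ht⟩ : ∃ t, i t ≠ 0 := by
      by_contra! hi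
      simp [hi] at hL
    have e : i - Pi.single t 1 + Pi.single t 1 = i := by
      refine tsub_add_cancel_of_le fun u => ?_
      by_cases hu : u = t
      · subst hu; simp; omega
      · simp [hu]
    rw [← e, ← cD_single k]
    refine h _ t (ih _ ?_)
    rw [← e, LoopLie.sum_add_single] at hL
    omega

/-- Derivatives of constants span the current algebra, and each argument in turn can be reduced to a
constant. -/
theorem assocTriple_all (a b c : Cur n A) : AssocTriple (n := n) k a b c := by
  induction a using induction_linear with
  | zero => exact assocTriple_zero_left
  | add _ _ h h' => exact h.add_left h'
  | single i x =>
    refine single_induction k (P := fun a => AssocTriple (n := n) k a b c)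
      ?_ (fun y t h => h.D_left t) i
    induction b using induction_linear with
    | zero => exact assocTriple_zero_middle
    | add _ _ h h' => exact h.add_middle h'
    | single i y =>
      refine single_induction k (P := fun b => AssocTriple (n := n) k (single 0 x) b c)
        ?_ (fun y t h => h.D_middle t) i
      induction c using induction_linear with
      | zero => exact assocTriple_zero_right
      | add _ _ h h' => exact h.add_right h'
      | single i z =>
        exact single_induction k (P := AssocTriple (n := n) k (single 0 x) (single 0 y))
          (assocTriple_zero k x y z) (fun y t h => h.D_right t) i

noncomputable instance : AssocNConformalAlgebra k n (Cur n A) where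
  assoc m m' a b c := assocTriple_all k a b c m m'

theorem cmul_zero_left (x : A) (i : Fin n → ℕ) (y : A) :
    cmul (C := Cur n A) k (0 : Fin n → ℕ) (single 0 x) (single i y) = single i (x * y) := by
  rw [cmul_single, coef_zero_left, one_smul, zero_add, tsub_zero]

end Cur

/-! ### Coefficients of normal words -/

namespace GS

open NConformalAlgebra ConfWord

theorem below_one {n : ℕ} {m : Fin n → ℕ} : Below m (fun _ => 1) ↔ m = 0 := by
  simp [Below, funext_iff]

theorem mem_preNormal_one {B : Type*} {n : ℕ} {u : List (B × (Fin n → ℕ))}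
    (hu : PreNormal (fun _ => 1) u) {l : B × (Fin n → ℕ)} (hl : l ∈ u) : l = (l.1, 0) :=
  Prod.ext rfl (below_one.1 (hu l hl))

theorem map_Dpow {k : Type*} {n : ℕ} {C C' : Type*} [Field k] [AddCommGroup C] [Module k C]
    [AddCommGroup C'] [Module k C'] [NConformalAlgebra k n C] [NConformalAlgebra k n C']
    (f : C →ₗ[k] C') (hf : ∀ (i : Fin n) x, f (cD k i x) = cD k i (f x)) (i : Fin n → ℕ) (x : C) :
    f (Dpow k i x) = Dpow k i (f x) := by
  have pow : ∀ (t : Fin n) (r : ℕ) (x : C),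
      f (((cD k t : Module.End k C) ^ r) x) = ((cD k t : Module.End k C') ^ r) (f x) := by
    intro t r
    induction r with
    | zero => simp
    | succ r ih => intro x; rw [pow_succ, pow_succ, Module.End.mul_apply, ih, hf]; rfl
  unfold Dpow
  induction List.finRange n generalizing x with
  | nil => simp
  | cons t l ih => simp only [List.map_cons, List.prod_cons, Module.End.mul_apply, pow, ih]

theorem Dpow_single (k : Type*) {n : ℕ} {A : Type*} [Field k] [Ring A] [Algebra k A]
    (i : Fin n → ℕ) (x : A) :
    Dpow (C := Cur n A) k i (Cur.single 0 x) = Cur.single i x := by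
  have pow : ∀ (t : Fin n) (r : ℕ) (j : Fin n → ℕ),
      ((cD k t : Module.End k (Cur n A)) ^ r) (Cur.single j x) =
        Cur.single (j + Pi.single t r) x := by
    intro t r
    induction r with
    | zero => simp
    | succ r ih =>
      intro j
      rw [pow_succ, Module.End.mul_apply, Cur.cD_single, ih, add_assoc, ← Pi.single_add, add_comm 1]
  -- `Dpow` is a product over a list, so the exponent is accumulated along arbitrary lists; over all
  -- of `Fin n` the sum of the `Pi.single t (i t)` is `i`.
  have list : ∀ (l : List (Fin n)) (j : Fin n → ℕ),
      ((l.map fun t => (cD k t : Module.End k (Cur n A)) ^ (i t)).prod) (Cur.single j x) =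
        Cur.single (j + (l.map fun t => Pi.single t (i t)).sum) x := by
    intro l
    induction l with
    | nil => simp
    | cons t l ih =>
      intro j
      rw [List.map_cons, List.prod_cons, Module.End.mul_apply, ih, pow, List.map_cons,
        List.sum_cons, add_assoc, add_comm (List.sum _)]
  rw [Dpow, list, zero_add]
  congr 1
  have := Finset.univ_sum_single i
  rw [← List.sum_toFinset _ (List.nodup_finRange n)]
  simpa using this

variable {k : Type*} {B : Type*} {n : ℕ} [Field k]

/-- The normal word `w` with its indices dropped, as an element of the free algebra. -/
noncomputable def monomial (k : Type*) [Field k] (w : ConfWord B n) :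
    MonoidAlgebra k (FreeMonoid B) :=
  MonoidAlgebra.single (FreeMonoid.ofList (w.pre.map Prod.fst ++ [w.last])) 1

/-- The universal property, applied to `b ↦ 1 ⊗ b`, gives `φ`. It separates normal words, since
their images are the distinct basis elements `D^i ⊗ word`. -/
theorem exists_hom_eval (k : Type*) [Field k] (B : Type*) (n : ℕ) :
    ∃ φ : Alg k B (fun _ : Fin n => 1) →ₗ[k] Cur n (MonoidAlgebra k (FreeMonoid B)),
      ∀ w : ConfWord B n, w.Normal (fun _ => 1) → φ (eval w) = Cur.single w.ind (monomial k w) := by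
  obtain ⟨φ, ⟨hD, hm, hg⟩, -⟩ := FreeConf.existsUnique_lift (k := k)
    (N := fun _ _ : B => fun _ : Fin n => 1) (A := Cur n (MonoidAlgebra k (FreeMonoid B)))
    (fun b => Cur.single 0 (MonoidAlgebra.single (FreeMonoid.of b) 1)) (fun a b m h => by
      rw [Cur.cmul_zero_single, if_neg (fun h' => h (below_one.2 h'))])
  refine ⟨φ, fun ⟨u, b, i⟩ hw => ?_⟩
  change PreNormal _ u at hw
  induction u with
  | nil =>
    change φ (Dpow k i _) = _
    rw [map_Dpow φ hD, hg, Dpow_single]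
    rfl
  | cons l u ih =>
    have hl := mem_preNormal_one hw (List.mem_cons_self ..)
    have := ih fun l hl => hw l (List.mem_cons_of_mem _ hl)
    rw [hl]
    change φ (cmul k 0 _ (eval ⟨u, b, i⟩)) = _
    rw [hm, this, hg, Cur.cmul_zero_left]
    simp [monomial, MonoidAlgebra.single_mul_single, FreeMonoid.ofList_cons]

/-- All the indices `mⱼ` of a normal word are `0`, so forgetting them loses nothing. -/
theorem normal_one_ext {u w : ConfWord B n} (hu : u.Normal fun _ => 1) (hw : w.Normal fun _ => 1)
    (h : u.pre.map Prod.fst ++ [u.last] = w.pre.map Prod.fst ++ [w.last]) (h' : u.ind = w.ind) :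
    u = w := by
  obtain ⟨h₁, h₂⟩ := List.append_inj' h rfl
  have key : ∀ v : ConfWord B n, v.Normal (fun _ => 1) →
      v.pre = (v.pre.map Prod.fst).map fun b => (b, (0 : Fin n → ℕ)) := fun v hv => by
    conv_lhs => rw [← List.map_id v.pre]
    rw [List.map_map]
    exact List.map_congr_left fun l hl => mem_preNormal_one hv hl
  refine ConfWord.ext ?_ (by simpa using h₂) h'
  rw [key u hu, key w hw, h₁]

/-- The coefficient of a normal word. -/
theorem exists_coeff {w : ConfWord B n} (hw : w.Normal fun _ => 1) :
    ∃ c : Alg k B (fun _ : Fin n => 1) →ₗ[k] k, c (eval w) = 1 ∧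
      ∀ u : ConfWord B n, u.Normal (fun _ => 1) → u ≠ w → c (eval u) = 0 := by
  obtain ⟨φ, hφ⟩ := exists_hom_eval k B n
  let x := FreeMonoid.ofList (w.pre.map Prod.fst ++ [w.last])
  let d : Cur n (MonoidAlgebra k (FreeMonoid B)) →ₗ[k] k :=
    Finsupp.lapply x ∘ₗ (MonoidAlgebra.coeffLinearEquiv k).toLinearMap ∘ₗ
      (Finsupp.lapply w.ind : ((Fin n → ℕ) →₀ MonoidAlgebra k (FreeMonoid B)) →ₗ[k] _)
  have hd : ∀ i a, d (Cur.single i a) = (Finsupp.single i a w.ind).coeff x := fun i a => rfl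
  refine ⟨d ∘ₗ φ, ?_, fun u hu huw => ?_⟩
  · rw [LinearMap.comp_apply, hφ w hw, hd, Finsupp.single_eq_same]
    simp [monomial, x]
  · rw [LinearMap.comp_apply, hφ u hu, hd]
    by_cases h : u.ind = w.ind
    · rw [h, Finsupp.single_eq_same, monomial, MonoidAlgebra.coeff_single,
        Finsupp.single_eq_of_ne]
      intro h'
      exact huw (normal_one_ext hu hw (FreeMonoid.ofList.injective h').symm h)
    · rw [Finsupp.single_eq_of_ne (Ne.symm h)]
      simp

/-! ### Uniqueness of the leading word -/

variable [LinearOrder B]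

theorem word_lt_asymm {u w : ConfWord B n} (h : u < w) : ¬ w < u := by
  have : Std.Asymm (letterLT : B × (Fin n → ℕ) → B × (Fin n → ℕ) → Prop) := ⟨by
    rintro x y (h | ⟨h, h'⟩) (g | ⟨g, g'⟩)
    · exact lt_asymm h g
    · exact h.ne g.symm
    · exact g.ne h.symm
    · exact lt_asymm h' g'⟩
  intro h'
  change _ < _ ∨ _ ∧ _ at h h'
  rcases h with h | ⟨h, g⟩ <;> rcases h' with h' | ⟨h', g'⟩
  · exact lt_asymm h h'
  · exact h.ne h'.symm
  · exact h'.ne h.symm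
  · exact asymm_of (List.Lex letterLT) g g'

/-- If `p ≠ q` and `p < q` fails, the coefficient of `p` in `f` is `1` by the expansion at `p` and
`0` by the one at `q`. Hence distinct leading words would each precede the other; only asymmetry of
the order is needed. -/
theorem MonicLeading.unique {f : Alg k B (fun _ : Fin n => 1)} {p q : ConfWord B n}
    (hp : MonicLeading f p) (hq : MonicLeading f q) : p = q := by
  have key : ∀ {p q : ConfWord B n}, MonicLeading f p → MonicLeading f q → p ≠ q → p < q := by
    intro p q ⟨_, np, hp⟩ ⟨_, nq, hq⟩ hpq
    obtain ⟨c, c₁, c₀⟩ := exists_coeff (k := k) np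
    by_contra hlt
    have h₁ : c (f - (1 : k) • eval p) = 0 := by
      refine (Submodule.span_le (p := LinearMap.ker c)).2 ?_ hp
      rintro x ⟨u, nu, hu, rfl⟩
      exact c₀ u nu fun h => word_lt_asymm hu (h ▸ h ▸ hu)
    have h₂ : c (f - (1 : k) • eval q) = 0 := by
      refine (Submodule.span_le (p := LinearMap.ker c)).2 ?_ hq
      rintro x ⟨u, nu, hu, rfl⟩
      exact c₀ u nu fun h => hlt (h ▸ hu)
    rw [map_sub, map_smul, c₁, one_smul, sub_eq_zero] at h₁
    rw [map_sub, map_smul, c₀ q nq hpq.symm, smul_zero, sub_zero, h₁] at h₂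
    exact one_ne_zero h₂
  by_contra hpq
  exact word_lt_asymm (key hp hq hpq) (key hq hp (Ne.symm hpq))

end GS

/-! ### `D`-free elements for the locality function `(1, …, 1)` -/

namespace GS

open NConformalAlgebra ConfWord

section

variable {k : Type*} {B : Type*} {n : ℕ} [Field k]

theorem Dpow_zero {C : Type*} [AddCommGroup C] [Module k C] [NConformalAlgebra k n C] (x : C) :
    Dpow k (0 : Fin n → ℕ) x = x := by
  have : ∀ l : List (Fin n), (l.map fun t => (cD k t : Module.End k C) ^ ((0 : Fin n → ℕ) t)).prod
      = 1 := by
    intro l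
    induction l with
    | nil => rfl
    | cons t l ih => rw [List.map_cons, List.prod_cons, ih, Pi.zero_apply, pow_zero, one_mul]
  rw [Dpow, this]
  rfl

/-- For `m = 0` the associativity sum has the single term `s = 0`. -/
theorem cmul_zero_assoc {C : Type*} [AddCommGroup C] [Module k C] [AssocNConformalAlgebra k n C]
    (x y z : C) : cmul k (0 : Fin n → ℕ) (cmul k (0 : Fin n → ℕ) x y) z =
      cmul k (0 : Fin n → ℕ) x (cmul k (0 : Fin n → ℕ) y z) := by
  have : (Finset.Iic (0 : Fin n → ℕ)) = {0} := by ext; simp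
  have h := AssocNConformalAlgebra.assoc (k := k) (0 : Fin n → ℕ) 0 x y z
  rw [this, Finset.sum_singleton] at h
  simpa using h

theorem eval_nil {N : Fin n → ℕ} (b : B) :
    eval (k := k) (N := N) ⟨[], b, 0⟩ = FreeConf.gen k _ b :=
  Dpow_zero _

theorem gen_mul_eval {N : Fin n → ℕ} (b : B) (m : Fin n → ℕ) (w : ConfWord B n) :
    cmul k m (FreeConf.gen k (fun _ _ : B => N) b) (eval w) = eval ⟨(b, m) :: w.pre, w.last, w.ind⟩ :=
  rfl

theorem dFree_gen {N : Fin n → ℕ} (b : B) : DFree (FreeConf.gen k (fun _ _ : B => N) b) :=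
  Submodule.subset_span ⟨⟨[], b, 0⟩, by simp [ConfWord.Normal, PreNormal], rfl, (eval_nil b).symm⟩

theorem DFree.gen_mul {x : Alg k B (fun _ : Fin n => 1)} (hx : DFree x) (b : B) :
    DFree (cmul k (0 : Fin n → ℕ) (FreeConf.gen k _ b) x) := by
  refine (Submodule.span_le (p := (Submodule.span k _).comap
    (cmul k (0 : Fin n → ℕ) (FreeConf.gen k _ b)))).2 ?_ hx
  rintro _ ⟨w, hw, hi, rfl⟩
  refine Submodule.subset_span ⟨⟨(b, 0) :: w.pre, w.last, w.ind⟩, ?_, hi, rfl⟩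
  intro l hl
  rcases List.mem_cons.1 hl with rfl | hl
  · exact below_one.2 rfl
  · exact hw l hl

theorem DFree.mul_gen {x : Alg k B (fun _ : Fin n => 1)} (hx : DFree x) (b : B) :
    DFree (cmul k (0 : Fin n → ℕ) x (FreeConf.gen k _ b)) := by
  refine (Submodule.span_le (p := (Submodule.span k _).comap
    ((cmul k (0 : Fin n → ℕ)).flip (FreeConf.gen k _ b)))).2 ?_ hx
  rintro _ ⟨⟨u, c, i⟩, hw, hi, rfl⟩
  change i = 0 at hi
  subst hi
  change DFree (cmul k (0 : Fin n → ℕ) (eval _) (FreeConf.gen k _ b))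
  change PreNormal _ u at hw
  induction u with
  | nil =>
    rw [eval_nil]
    exact (dFree_gen b).gen_mul c
  | cons l u ih =>
    rw [mem_preNormal_one hw (List.mem_cons_self ..), ← gen_mul_eval l.1 0 ⟨u, c, 0⟩,
      cmul_zero_assoc]
    exact (ih fun l hl => hw l (List.mem_cons_of_mem _ hl)).gen_mul _

/-- Generators annihilate the `D`-free elements in all products `⟨m⟩` with `m ≠ 0`. -/
theorem DFree.gen_mul_eq_zero {x : Alg k B (fun _ : Fin n => 1)} (hx : DFree x) (b : B)
    {m : Fin n → ℕ} (hm : m ≠ 0) : cmul k m (FreeConf.gen k _ b) x = 0 := by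
  refine (Submodule.span_le (p := LinearMap.ker (cmul k m (FreeConf.gen k _ b)))).2 ?_ hx
  rintro _ ⟨⟨u, c, i⟩, hw, hi, rfl⟩
  change i = 0 at hi
  subst hi
  change PreNormal _ u at hw
  change cmul k m (FreeConf.gen k _ b) (eval _) = 0
  have local_gen : ∀ (b c : B) {m : Fin n → ℕ}, m ≠ 0 →
      cmul k m (FreeConf.gen k (fun _ _ : B => fun _ : Fin n => 1) b) (FreeConf.gen k _ c) = 0 :=
    fun b c m hm => FreeConf.qmul_gen k _ b c m fun h => hm (below_one.1 h)
  induction u generalizing b m with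
  | nil =>
    rw [eval_nil]
    exact local_gen b c hm
  | cons l u ih =>
    have ih := fun b {m} hm => @ih b m hm fun l hl => hw l (List.mem_cons_of_mem _ hl)
    rw [mem_preNormal_one hw (List.mem_cons_self ..), ← gen_mul_eval l.1 0 ⟨u, c, 0⟩]
    -- Expand `(b⟨m⟩l)⟨0⟩x`, which is zero by locality. By induction `l⟨s⟩x = 0` for `s ≠ 0`, so the
    -- remaining term `b⟨m⟩(l⟨0⟩x)` is zero as well.
    have h := AssocNConformalAlgebra.assoc (k := k) m 0 (FreeConf.gen k _ b)
      (FreeConf.gen k _ l.1) (eval (k := k) (N := fun _ : Fin n => 1) ⟨u, c, 0⟩)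
    have h₀ := local_gen b l.1 hm
    rw [h₀, map_zero, LinearMap.zero_apply,
      Finset.sum_eq_single_of_mem 0 (by simp)] at h
    · simpa using h.symm
    · intro s _ hs
      rw [zero_add, ih l.1 hs, map_zero, smul_zero]

end

/-! ### The commutator relations -/

open LoopLie

variable {k : Type*} [Field k] {n : ℕ} {g : Type*} [LieRing g] [LieAlgebra k g]
  {ι : Type*} (a : Module.Basis ι k g)

/-- The embedding `g → C` that extends `aᵢ ↦ aᵢ`. -/
noncomputable def embed (n : ℕ) : g →ₗ[k] Alg k ι (fun _ : Fin n => 1) :=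
  a.constr k (FreeConf.gen k (oneLoc n ι))

theorem embed_basis (i : ι) : embed a n (a i) = FreeConf.gen k _ i :=
  a.constr_basis k _ i

/-- The defect `x⟨0⟩y - y⟨0⟩x - [x y]`. -/
noncomputable def commutatorDefect (n : ℕ) (x y : g) : Alg k ι (fun _ : Fin n => 1) :=
  cmul k (0 : Fin n → ℕ) (embed a n x) (embed a n y) -
    cmul k (0 : Fin n → ℕ) (embed a n y) (embed a n x) - embed a n ⁅x, y⁆

theorem commutatorDefect_self (x : g) : commutatorDefect a n x x = 0 := by
  simp [commutatorDefect]

theorem commutatorDefect_swap (x y : g) :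
    commutatorDefect a n y x = -commutatorDefect a n x y := by
  rw [commutatorDefect, commutatorDefect, ← lie_skew, map_neg]
  abel

theorem embed_mem_span (x : g) : embed a n x ∈ Submodule.span k
    (Set.range fun i => eval (k := k) (N := fun _ : Fin n => 1) (⟨[], i, 0⟩ : ConfWord ι n)) := by
  induction a.mem_span x using Submodule.span_induction with
  | mem x hx =>
    obtain ⟨i, rfl⟩ := hx
    rw [embed_basis]
    exact Submodule.subset_span ⟨i, eval_nil i⟩
  | zero => simp
  | add x y _ _ hx hy => rw [map_add]; exact add_mem hx hy
  | smul c x _ hx => rw [map_smul]; exact Submodule.smul_mem _ c hx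

theorem dFree_embed (x : g) : DFree (embed a n x) := by
  refine Submodule.span_mono ?_ (embed_mem_span a x)
  rintro _ ⟨i, rfl⟩
  exact ⟨⟨[], i, 0⟩, by simp [ConfWord.Normal, PreNormal], rfl, rfl⟩

/-- The word `aᵢ⟨0⟩aⱼ`. -/
def pair (n : ℕ) (i j : ι) : ConfWord ι n := ⟨[(i, 0)], j, 0⟩

theorem pair_normal (i j : ι) : (pair n i j).Normal fun _ => 1 := fun l hl => by
  rw [pair, List.mem_singleton] at hl
  subst hl
  exact below_one.2 rfl

theorem eval_pair (i j : ι) : eval (pair n i j) =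
    cmul k (0 : Fin n → ℕ) (FreeConf.gen k (fun _ _ => fun _ => 1) i) (FreeConf.gen k _ j) := by
  rw [← eval_nil j]
  rfl

theorem dFree_commutatorDefect (i j : ι) : DFree (commutatorDefect a n (a i) (a j)) := by
  rw [commutatorDefect, embed_basis, embed_basis]
  exact sub_mem (sub_mem ((dFree_gen j).gen_mul i) ((dFree_gen i).gen_mul j)) (dFree_embed a _)

/-- The intersection composition of two commutator relations. -/
theorem overlap_identity (x y z : g) :
    cmul k (0 : Fin n → ℕ) (commutatorDefect a n x y) (embed a n z) -
        cmul k (0 : Fin n → ℕ) (embed a n x) (commutatorDefect a n y z) =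
      cmul k (0 : Fin n → ℕ) (commutatorDefect a n x z) (embed a n y) +
        cmul k (0 : Fin n → ℕ) (embed a n z) (commutatorDefect a n x y) -
        cmul k (0 : Fin n → ℕ) (embed a n y) (commutatorDefect a n x z) -
        cmul k (0 : Fin n → ℕ) (commutatorDefect a n y z) (embed a n x) +
        (commutatorDefect a n x ⁅y, z⁆ + commutatorDefect a n y ⁅z, x⁆ +
          commutatorDefect a n z ⁅x, y⁆) := by
  have jacobi : embed a n ⁅x, ⁅y, z⁆⁆ + embed a n ⁅y, ⁅z, x⁆⁆ + embed a n ⁅z, ⁅x, y⁆⁆ = 0 := by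
    rw [← map_add, ← map_add, lie_jacobi, map_zero]
  have skew : embed a n ⁅x, z⁆ = -embed a n ⁅z, x⁆ := by rw [← lie_skew, map_neg]
  simp only [commutatorDefect, map_sub, LinearMap.sub_apply, cmul_zero_assoc, skew, map_neg,
    LinearMap.neg_apply]
  -- The cubic terms cancel by associativity and the quadratic ones by skew-symmetry; what remains
  -- of the difference is exactly the Jacobi sum.
  rw [← sub_eq_zero, ← jacobi]
  abel

theorem pair_injective {i j i' j' : ι} (h : pair n i j = pair n i' j') : i = i' ∧ j = j' := by
  simpa [pair] using h

/-- On generators the flip for `m = 0` is the opposite product. -/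
theorem flip_gen {B : Type*} (b c : B) :
    NConformalAlgebra.flip k (0 : Fin n → ℕ) (FreeConf.gen k (oneLoc n B) b) (FreeConf.gen k _ c) =
      cmul k (0 : Fin n → ℕ) (FreeConf.gen k _ b) (FreeConf.gen k _ c) := by
  rw [NConformalAlgebra.flip, finsum_eq_single _ 0]
  · simp [Dpow_zero]
  · intro s hs
    have : cmul k s (FreeConf.gen k (oneLoc n B) b) (FreeConf.gen k _ c) = 0 :=
      FreeConf.qmul_gen k _ b c s fun h => hs (below_one.1 h)
    rw [zero_add, this, map_zero, smul_zero]

theorem toFree_bracket (x y : g) :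
    toFree n a (cmul k (0 : Fin n → ℕ) (of n x) (of n y)) = embed a n ⁅x, y⁆ := by
  have h : cmul k (0 : Fin n → ℕ) (of n x) (of n y) = Finsupp.single 0 ⁅x, y⁆ := by
    refine (bracket_single k 0 0 0 x y).trans ?_
    rw [Cur.coef_zero_zero, if_pos rfl, one_smul, add_zero, tsub_zero]
  rw [h, toFree, Finsupp.lsum_single, LinearMap.comp_apply, Dpow_zero]
  rfl

/-! ### Leading words and compositions of the commutator relations -/

variable [LinearOrder ι]

theorem mem_commutatorRelations {f : Alg k ι (fun _ : Fin n => 1)} :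
    f ∈ commutatorRelations n a ↔ ∃ i j, j < i ∧ f = commutatorDefect a n (a i) (a j) := by
  simp only [commutatorDefect, embed_basis]
  rfl

theorem word_lt_of_length {v w : ConfWord ι n} (h : v.length < w.length) : v < w := Or.inl h

/-- The word `aⱼ⟨0⟩aᵢ` has a smaller first letter, and the bracket is a combination of words of
length one. -/
theorem monicLeading_commutatorDefect {i j : ι} (h : j < i) :
    MonicLeading (commutatorDefect a n (a i) (a j)) (pair n i j) := by
  refine ⟨one_ne_zero, pair_normal i j, ?_⟩
  rw [one_smul, commutatorDefect, embed_basis, embed_basis, ← eval_pair, ← eval_pair]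
  rw [show ∀ x y z : Alg k ι (fun _ : Fin n => 1), x - y - z - x = -y - z from
    fun x y z => by abel]
  refine sub_mem (neg_mem (Submodule.subset_span ⟨pair n j i, pair_normal j i,
    Or.inr ⟨rfl, List.Lex.rel (Or.inl h)⟩, rfl⟩)) (Submodule.span_mono ?_ (embed_mem_span a _))
  rintro _ ⟨l, rfl⟩
  exact ⟨⟨[], l, 0⟩, by simp [ConfWord.Normal, PreNormal], word_lt_of_length (by simp [length, pair]), rfl⟩

/-- The defect is bilinear and alternating. This expresses the defects of brackets from
`overlap_identity`, and the diagonal enveloping relations, through the elements of `S`. -/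
theorem commutatorDefect_mem {T : Submodule k (Alg k ι (fun _ : Fin n => 1))}
    (h : ∀ i j, j < i → commutatorDefect a n (a i) (a j) ∈ T) (x y : g) :
    commutatorDefect a n x y ∈ T := by
  induction a.mem_span x using Submodule.span_induction with
  | mem x hx =>
    obtain ⟨i, rfl⟩ := hx
    induction a.mem_span y using Submodule.span_induction with
    | mem y hy =>
      obtain ⟨j, rfl⟩ := hy
      rcases lt_trichotomy i j with hij | rfl | hij
      · rw [commutatorDefect_swap]
        exact neg_mem (h j i hij)
      · rw [commutatorDefect_self]
        exact zero_mem T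
      · exact h i j hij
    | zero => simp [commutatorDefect]
    | add y y' _ _ hy hy' =>
      convert add_mem hy hy' using 1
      simp only [commutatorDefect, map_add, LinearMap.add_apply, lie_add]
      abel
    | smul c y _ hy =>
      convert Submodule.smul_mem _ c hy using 1
      simp only [commutatorDefect, map_smul, LinearMap.smul_apply, lie_smul, smul_sub]
  | zero => simp [commutatorDefect]
  | add y y' _ _ hy hy' =>
    convert add_mem hy hy' using 1
    simp only [commutatorDefect, map_add, LinearMap.add_apply, add_lie]
    abel
  | smul c y _ hy =>
    convert Submodule.smul_mem _ c hy using 1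
    simp only [commutatorDefect, map_smul, LinearMap.smul_apply, smul_lie, smul_sub]

theorem commutatorRelations_eq_pair {f : Alg k ι (fun _ : Fin n => 1)}
    (hf : f ∈ commutatorRelations n a) {p : ConfWord ι n} (hp : MonicLeading f p) :
    ∃ i j, j < i ∧ p = pair n i j ∧ f = commutatorDefect a n (a i) (a j) := by
  obtain ⟨i, j, hij, rfl⟩ := (mem_commutatorRelations a).1 hf
  exact ⟨i, j, hij, hp.unique (monicLeading_commutatorDefect a hij), rfl⟩

/-- The four cubic terms of `overlap_identity` are normal `S`-words on other permutations of `i, j,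
l`, all smaller than `i, j, l` since `i > j > l`; the defects of brackets have length two. Every
`S`-word used is `D`-free, so `f` and `f'` can be arbitrary. -/
theorem overlap_trivial {i j l : ι} (hij : j < i) (hjl : l < j) (f f' : Alg k ι fun _ : Fin n => 1) :
    TrivialMod (commutatorRelations n a) f f' ⟨[(i, 0), (j, 0)], l, 0⟩
      (cmul k (0 : Fin n → ℕ) (commutatorDefect a n (a i) (a j)) (embed a n (a l)) -
        cmul k (0 : Fin n → ℕ) (embed a n (a i)) (commutatorDefect a n (a j) (a l))) := by
  have mem : ∀ {i j}, j < i → commutatorDefect a n (a i) (a j) ∈ commutatorRelations n a :=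
    fun h => (mem_commutatorRelations a).2 ⟨_, _, h, rfl⟩
  have right : ∀ {i' j' l' : ι}, j' < i' →
      (⟨[(i', 0), (j', 0)], l', 0⟩ : ConfWord ι n) < ⟨[(i, 0), (j, 0)], l, 0⟩ →
      cmul k (0 : Fin n → ℕ) (commutatorDefect a n (a i') (a j')) (embed a n (a l')) ∈
        Submodule.span k {x | ∃ w', NormalSWord (commutatorRelations n a) x w' ∧
          w' < ⟨[(i, 0), (j, 0)], l, 0⟩ ∧ (DFree f ∧ DFree f' → DFree x)} := by
    intro i' j' l' h hlt
    rw [embed_basis]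
    refine Submodule.subset_span ⟨⟨[(i', 0), (j', 0)], l', 0⟩, ?_, hlt,
      fun _ => (dFree_commutatorDefect a i' j').mul_gen l'⟩
    rw [← eval_nil l']
    refine NormalSWord.first [] _ (pair n i' j') (some (0, ⟨[], l', 0⟩)) (mem h)
      (monicLeading_commutatorDefect a h) (dFree_commutatorDefect a i' j') (by simp [PreNormal]) ?_
    rintro _ ⟨⟩
    exact ⟨below_one.2 rfl, by simp [ConfWord.Normal, PreNormal]⟩
  have left : ∀ {i' j' l' : ι}, l' < j' →
      (⟨[(i', 0), (j', 0)], l', 0⟩ : ConfWord ι n) < ⟨[(i, 0), (j, 0)], l, 0⟩ →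
      cmul k (0 : Fin n → ℕ) (embed a n (a i')) (commutatorDefect a n (a j') (a l')) ∈
        Submodule.span k {x | ∃ w', NormalSWord (commutatorRelations n a) x w' ∧
          w' < ⟨[(i, 0), (j, 0)], l, 0⟩ ∧ (DFree f ∧ DFree f' → DFree x)} := by
    intro i' j' l' h hlt
    rw [embed_basis]
    refine Submodule.subset_span ⟨⟨[(i', 0), (j', 0)], l', 0⟩, ?_, hlt,
      fun _ => (dFree_commutatorDefect a j' l').gen_mul i'⟩
    refine NormalSWord.first [(i', 0)] _ (pair n j' l') none (mem h)
      (monicLeading_commutatorDefect a h) (dFree_commutatorDefect a j' l') ?_ (by simp [SufNormal])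
    intro x hx
    rw [List.mem_singleton.1 hx]
    exact below_one.2 rfl
  have short : ∀ x y : g, commutatorDefect a n x y ∈
        Submodule.span k {x | ∃ w', NormalSWord (commutatorRelations n a) x w' ∧
          w' < ⟨[(i, 0), (j, 0)], l, 0⟩ ∧ (DFree f ∧ DFree f' → DFree x)} := by
    refine commutatorDefect_mem a fun i' j' h => Submodule.subset_span ⟨pair n i' j', ?_,
      word_lt_of_length (by simp [length, pair]), fun _ => dFree_commutatorDefect a i' j'⟩
    exact NormalSWord.first [] _ (pair n i' j') none (mem h) (monicLeading_commutatorDefect a h)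
      (dFree_commutatorDefect a i' j') (by simp [PreNormal]) (by simp [SufNormal])
  have lt_first : ∀ {i' j' l' : ι}, i' < i →
      (⟨[(i', 0), (j', 0)], l', 0⟩ : ConfWord ι n) < ⟨[(i, 0), (j, 0)], l, 0⟩ :=
    fun h => Or.inr ⟨rfl, .rel (.inl h)⟩
  have lt_second : (⟨[(i, 0), (l, 0)], j, 0⟩ : ConfWord ι n) < ⟨[(i, 0), (j, 0)], l, 0⟩ :=
    Or.inr ⟨rfl, .cons (.rel (.inl hjl))⟩
  have hil := hjl.trans hij
  rw [TrivialMod, overlap_identity]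
  exact add_mem (sub_mem (sub_mem (add_mem (right hil lt_second) (left hij (lt_first hil)))
    (left hil (lt_first hij))) (right hjl (lt_first hij)))
    (add_mem (add_mem (short _ _) (short _ _)) (short _ _))

theorem isGroebnerShirshov_commutatorRelations :
    IsGroebnerShirshov (N := fun _ => 1) (commutatorRelations n a) where
  monic f hf := by
    obtain ⟨i, j, hij, rfl⟩ := (mem_commutatorRelations a).1 hf
    exact ⟨_, monicLeading_commutatorDefect a hij⟩
  including f hf f' hf' p q hp hq _ u v _ _ hw := by
    obtain ⟨i, j, hij, rfl, rfl⟩ := commutatorRelations_eq_pair a hf hp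
    obtain ⟨i', j', hij', rfl, rfl⟩ := commutatorRelations_eq_pair a hf' hq
    have hl := congrArg (fun w : ConfWord ι n => w.pre.length) hw
    cases v with
    | some v =>
      simp [pair, prepend, append] at hl
      omega
    | none =>
      -- Both leading words have length two, so nothing can surround the inner one and the two
      -- relations coincide.
      obtain rfl : u = [] := by simpa [pair, prepend, append] using hl
      obtain ⟨rfl, rfl⟩ := pair_injective hw
      rw [TrivialMod]
      convert Submodule.zero_mem _
      exact sub_self _
  right_including f hf f' hf' p q hp hq u d d' _ hd hw := by
    obtain ⟨i, j, hij, rfl, rfl⟩ := commutatorRelations_eq_pair a hf hp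
    obtain ⟨i', j', hij', rfl, rfl⟩ := commutatorRelations_eq_pair a hf' hq
    have hl := congrArg (fun w : ConfWord ι n => w.pre.length) hw
    obtain rfl : u = [] := by simpa [pair, prepend, appD] using hl
    have h : (i = i' ∧ j = j') ∧ d = d' := by
      simpa [pair, prepend, appD, and_assoc] using hw
    obtain ⟨⟨rfl, rfl⟩, rfl⟩ := h
    rw [TrivialMod]
    convert Submodule.zero_mem _
    exact sub_self _
  intersection f hf f' hf' p q hp hq _ u v hu hv hw hlen := by
    obtain ⟨i, j, hij, rfl, rfl⟩ := commutatorRelations_eq_pair a hf hp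
    obtain ⟨i', j', hij', rfl, rfl⟩ := commutatorRelations_eq_pair a hf' hq
    have hl := congrArg (fun w : ConfWord ι n => w.pre.length) hw
    cases v with
    | none =>
      obtain rfl : u = [] := by simpa [pair, prepend, append] using hl
      obtain ⟨rfl, rfl⟩ := pair_injective hw
      rw [TrivialMod]
      convert Submodule.zero_mem _
      exact sub_self _
    | some v =>
      obtain ⟨m, ⟨v, l, d⟩⟩ := v
      obtain ⟨hm, -⟩ := hv _ rfl
      obtain rfl : m = 0 := below_one.1 hm
      -- The overlap has length less than `2 + 2`, hence equal to three: one letter follows `f` and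
      -- one precedes `g`.
      obtain rfl : v = [] := by
        rw [← List.length_eq_zero_iff]
        simp [pair, append, length] at hlen
        omega
      obtain ⟨b, rfl⟩ : ∃ b, u = [b] := by
        rw [← List.length_eq_one_iff]
        simp [pair, prepend, append] at hl
        omega
      obtain ⟨rfl, rfl, rfl, rfl⟩ : b = (i, 0) ∧ i' = j ∧ j' = l ∧ d = 0 := by
        simp [pair, prepend, append] at hw
        tauto
      have := overlap_trivial a (n := n) hij hij' (commutatorDefect a n (a i) (a i'))
        (commutatorDefect a n (a i') (a j'))
      rw [embed_basis, embed_basis, ← eval_nil] at this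
      exact this
  left_mul f hf b m hm := by
    obtain ⟨i, j, hij, rfl⟩ := (mem_commutatorRelations a).1 hf
    -- Here `¬ Below m 1` means `m ≠ 0`, so the composition itself is zero.
    exact Or.inl ((dFree_commutatorDefect a i j).gen_mul_eq_zero b fun h => hm (below_one.2 h))
  right_mul f hf hD := by
    obtain ⟨i, j, hij, rfl⟩ := (mem_commutatorRelations a).1 hf
    exact absurd (dFree_commutatorDefect a i j) hD

/-! ### The defining ideal of the universal enveloping algebra -/

theorem mem_envelopingRelations {f : Alg k ι (fun _ : Fin n => 1)} :
    f ∈ envelopingRelations n a ↔ ∃ i j, j ≤ i ∧ f = commutatorDefect a n (a i) (a j) := by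
  have key : ∀ i j : ι, cmul k (0 : Fin n → ℕ) (FreeConf.gen k (oneLoc n ι) i) (FreeConf.gen k _ j)
      - NConformalAlgebra.flip k (0 : Fin n → ℕ) (FreeConf.gen k _ j) (FreeConf.gen k _ i)
      - toFree n a (cmul k (0 : Fin n → ℕ) (of n (a i)) (of n (a j))) = commutatorDefect a n (a i) (a j) := by
    intro i j
    rw [flip_gen, toFree_bracket, commutatorDefect, embed_basis, embed_basis]
  constructor
  · rintro ⟨i, j, m, hij, hm, rfl⟩
    obtain rfl : m = 0 := below_one.1 hm
    exact ⟨i, j, hij, key i j⟩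
  · rintro ⟨i, j, hij, rfl⟩
    exact ⟨i, j, 0, hij, below_one.2 rfl, (key i j).symm⟩

/-- The two generating sets lie in the same subspaces, hence in the same conformal ideals, because
the additional relations with `i = j` are zero. -/
theorem conformalIdeal_commutatorRelations :
    conformalIdeal k n (commutatorRelations n a) = envelopingIdeal n a := by
  rw [envelopingIdeal, conformalIdeal, conformalIdeal]
  congr 1
  ext J
  refine and_congr_left fun _ => ⟨fun h f hf => ?_, fun h f hf => h ?_⟩
  · obtain ⟨i, j, -, rfl⟩ := (mem_envelopingRelations a).1 hf
    exact commutatorDefect_mem a (T := J)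
      (fun i j hij => h ((mem_commutatorRelations a).2 ⟨i, j, hij, rfl⟩)) _ _
  · obtain ⟨i, j, hij, rfl⟩ := (mem_commutatorRelations a).1 hf
    exact (mem_envelopingRelations a).2 ⟨i, j, hij.le, rfl⟩

end GS

/-- Let `g` be a Lie algebra over a field `k` of characteristic zero with a linear basis `(aᵢ)`
indexed by a linearly ordered set. In the free associative `2`-conformal algebra
`C({aᵢ}, (1,1), D₁, D₂)`, the elements `aᵢ⟨0,0⟩aⱼ - aⱼ⟨0,0⟩aᵢ - [aᵢ aⱼ]`, `i > j`, form a
Gröbner–Shirshov basis, and the `2`-conformal ideal they generate is the defining ideal of the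
universal enveloping algebra of the loop Lie `2`-conformal algebra of `g`. -/
theorem mainTheorem9 {k : Type*} [Field k] [CharZero k] {g : Type*} [LieRing g] [LieAlgebra k g]
    {ι : Type*} [LinearOrder ι] (a : Module.Basis ι k g) :
    GS.IsGroebnerShirshov (LoopLie.commutatorRelations 2 a) ∧
      NConformalAlgebra.conformalIdeal k 2 (LoopLie.commutatorRelations 2 a) =
        LoopLie.envelopingIdeal 2 a :=
  ⟨GS.isGroebnerShirshov_commutatorRelations a, GS.conformalIdeal_commutatorRelations a⟩
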